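/- Let $k$ be an algebraically closed field of characteristic $p>0$, and let $G$ be a simple finite group scheme over $k$, that is, a finite group scheme which is not the trivial group scheme $\operatorname{Spec} k$ and whose only closed normal subgroup schemes are the trivial one and $G$ itself. Then at least one of the following holds. (a) There is a (finite) simple group $\Gamma$ such that $G$ is isomorphic, as a group scheme over $k$, to the constant group scheme attached to $\Gamma$, i.e. to the spectrum of the Hopf algebra of functions $\Gamma\to k$ (the dual of the group algebra $k[\Gamma]$). (b) There is a finite-dimensional simple restricted Lie algebra $(L,[p])$ over $k$ such that $G$ is isomorphic, as a group scheme over $k$, to the finite group scheme of height $1$ corresponding to $L$, i.e. to the spectrum of the dual of the restricted enveloping Hopf algebra $U^{[p]}(L)=U(L)/(x^p-x^{[p]} : x\in L)$, in which the elements of $L$ are primitive. Here a restricted Lie algebra is a Lie algebra $L$ over $k$ with a map $[p]:L\to L$ such that $\operatorname{ad}(x^{[p]})=\operatorname{ad}(x)^p$, $(\alpha x)^{[p]}=\alpha^p x^{[p]}$ and $(x_0+x_1)^{[p]}=x_0^{[p]}+x_1^{[p]}+\sum_{r=1}^{p-1}s_r(x_0,x_1)$, where $s_r(x_0,x_1)=-\frac1r\sum_u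 \operatorname{ad}x_{u(1)}\circ\cdots\circ\operatorname{ad}x_{u(p-1)}(x_1)$, the sum being over the maps $u:\{1,\dots,p-1\}\to\{0,1\}$ that take the value $0$ exactly $r$ times. It is called simple if $L\neq 0$ and the only Lie ideals of $L$ closed under the $p$-map are $0$ and $L$. (The group $\Gamma$ may be cyclic of prime order, and $L$ may be abelian of dimension one.) -/

import Mathlib

open CategoryTheory AlgebraicGeometry TensorProduct

universe u

noncomputable section

/-! ### The dual of a finite-dimensional cocommutative Hopf algebra -/

/-- The linear dual `H*` of a Hopf algebra `H` over a field; its multiplication is the convolution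
product `(f * g) h = ∑ f h₍₁₎ * g h₍₂₎` and its unit is the counit of `H`. -/
def HopfDual (k H : Type*) [Field k] [Ring H] [HopfAlgebra k H] : Type _ :=
  WithConv (H →ₗ[k] k)

namespace HopfDual

open Coalgebra

variable {k H : Type*} [Field k] [Ring H] [HopfAlgebra k H]

instance instRing : Ring (HopfDual k H) :=
  inferInstanceAs (Ring (WithConv (H →ₗ[k] k)))

instance instAlgebra : Algebra k (HopfDual k H) :=
  inferInstanceAs (Algebra k (WithConv (H →ₗ[k] k)))

instance instCommRing [IsCocomm k H] : CommRing (HopfDual k H) where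
  mul_comm := fun f g ↦
    mul_comm (show WithConv (H →ₗ[k] k) from f) (show WithConv (H →ₗ[k] k) from g)

variable (k H) in
/-- The underlying vector space of the dual Hopf algebra is the dual vector space. -/
def equivDual : HopfDual k H ≃ₗ[k] Module.Dual k H where
  toFun f := WithConv.ofConv f
  invFun f := WithConv.toConv f
  map_add' _ _ := rfl
  map_smul' _ _ := rfl
  left_inv _ := rfl
  right_inv _ := rfl

instance : CoeFun (HopfDual k H) fun _ ↦ H → k where
  coe f := equivDual k H f

@[ext]
theorem ext {f g : HopfDual k H} (h : ∀ a : H, f a = g a) : f = g :=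
  (equivDual k H).injective (LinearMap.ext h)

theorem mul_def (f g : HopfDual k H) (a : H) : (f * g) a =
    LinearMap.mul' k k (TensorProduct.map (equivDual k H f) (equivDual k H g) (comul a)) := rfl

theorem mul_repr (f g : HopfDual k H) {ι : Type*} {a : H} (r : Coalgebra.Repr k a ι) :
    (f * g) a = ∑ i ∈ r.index, f (r.left i) * g (r.right i) :=
  r.convMul_apply (A := k) (show WithConv (H →ₗ[k] k) from f) (show WithConv (H →ₗ[k] k) from g)

@[simp]
theorem one_apply (a : H) : (1 : HopfDual k H) a = counit (R := k) a := rfl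

@[simp]
theorem algebraMap_apply (c : k) (a : H) :
    (algebraMap k (HopfDual k H) c) a = c * counit (R := k) a := rfl

/-- The pairing `(f ⊗ g, a ⊗ b) ↦ f a * g b` as a linear isomorphism `H* ⊗ H* ≃ (H ⊗ H)*`. -/
def tensorEquiv (k H : Type*) [Field k] [Ring H] [HopfAlgebra k H] [Module.Finite k H] :
    HopfDual k H ⊗[k] HopfDual k H ≃ₗ[k] Module.Dual k (H ⊗[k] H) :=
  TensorProduct.congr (equivDual k H) (equivDual k H) ≪≫ₗ TensorProduct.dualDistribEquiv k H H

@[simp]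
theorem tensorEquiv_tmul [Module.Finite k H] (f g : HopfDual k H) (a b : H) :
    tensorEquiv k H (f ⊗ₜ g) (a ⊗ₜ b) = f a * g b := by
  simp [tensorEquiv, TensorProduct.dualDistribEquivOfBasis]

theorem tensor_ext [Module.Finite k H] {s t : HopfDual k H ⊗[k] HopfDual k H}
    (h : ∀ a b : H, tensorEquiv k H s (a ⊗ₜ b) = tensorEquiv k H t (a ⊗ₜ b)) : s = t :=
  (tensorEquiv k H).injective (TensorProduct.ext' h)

/-- The comultiplication of the dual: `f₍₁₎ a * f₍₂₎ b = f (a * b)`. -/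
def comulMap (k H : Type*) [Field k] [Ring H] [HopfAlgebra k H] [Module.Finite k H] :
    HopfDual k H →ₗ[k] HopfDual k H ⊗[k] HopfDual k H :=
  (tensorEquiv k H).symm.toLinearMap ∘ₗ (LinearMap.mul' k H).dualMap ∘ₗ
    (equivDual k H).toLinearMap

@[simp]
theorem tensorEquiv_comulMap [Module.Finite k H] (f : HopfDual k H) (a b : H) :
    tensorEquiv k H (comulMap k H f) (a ⊗ₜ b) = f (a * b) := by
  simp [comulMap]

/-- The counit of the dual: evaluation at `1`. -/
def counitMap (k H : Type*) [Field k] [Ring H] [HopfAlgebra k H] : HopfDual k H →ₗ[k] k :=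
  LinearMap.applyₗ (1 : H) ∘ₗ (equivDual k H).toLinearMap

@[simp]
theorem counitMap_apply (f : HopfDual k H) : counitMap k H f = f 1 := rfl

/-- The antipode of the dual: precomposition with the antipode of `H`. -/
def antipodeMap (k H : Type*) [Field k] [Ring H] [HopfAlgebra k H] :
    HopfDual k H →ₗ[k] HopfDual k H :=
  (equivDual k H).symm.toLinearMap ∘ₗ
    (HopfAlgebra.antipode k (A := H)).dualMap ∘ₗ
      (equivDual k H).toLinearMap

@[simp]
theorem antipodeMap_apply (f : HopfDual k H) (a : H) :
    antipodeMap k H f a = f (HopfAlgebra.antipode k a) := rfl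

/-- The pairing of `H* ⊗ (H* ⊗ H*)` with `H ⊗ (H ⊗ H)` as a linear isomorphism. -/
def tensorEquiv₃ (k H : Type*) [Field k] [Ring H] [HopfAlgebra k H] [Module.Finite k H] :
    HopfDual k H ⊗[k] (HopfDual k H ⊗[k] HopfDual k H) ≃ₗ[k] Module.Dual k (H ⊗[k] (H ⊗[k] H)) :=
  TensorProduct.congr (equivDual k H) (tensorEquiv k H) ≪≫ₗ
    TensorProduct.dualDistribEquiv k H (H ⊗[k] H)

@[simp]
theorem tensorEquiv₃_tmul [Module.Finite k H] (f : HopfDual k H)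
    (t : HopfDual k H ⊗[k] HopfDual k H) (a : H) (b : H ⊗[k] H) :
    tensorEquiv₃ k H (f ⊗ₜ t) (a ⊗ₜ b) = f a * tensorEquiv k H t b := by
  simp [tensorEquiv₃, TensorProduct.dualDistribEquivOfBasis]

theorem tensor_ext₃ [Module.Finite k H]
    {s t : HopfDual k H ⊗[k] (HopfDual k H ⊗[k] HopfDual k H)}
    (h : ∀ a b c : H, tensorEquiv₃ k H s (a ⊗ₜ (b ⊗ₜ c)) = tensorEquiv₃ k H t (a ⊗ₜ (b ⊗ₜ c))) :
    s = t := by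
  apply (tensorEquiv₃ k H).injective
  ext a b c
  exact h a b c

theorem tensorEquiv₃_assoc [Module.Finite k H] (t : HopfDual k H ⊗[k] HopfDual k H) (a b c : H) :
    tensorEquiv₃ k H (TensorProduct.assoc k _ _ _ ((comulMap k H).rTensor _ t))
      (a ⊗ₜ (b ⊗ₜ c)) = tensorEquiv k H t ((a * b) ⊗ₜ c) := by
  have aux (s : HopfDual k H ⊗[k] HopfDual k H) (g : HopfDual k H) :
      tensorEquiv₃ k H (TensorProduct.assoc k _ _ _ (s ⊗ₜ g)) (a ⊗ₜ (b ⊗ₜ c)) =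
        tensorEquiv k H s (a ⊗ₜ b) * g c := by
    induction s with
    | zero => simp
    | tmul x y => simp [mul_assoc]
    | add x y hx hy => simp only [TensorProduct.add_tmul, map_add, LinearMap.add_apply, hx, hy,
        add_mul]
  induction t with
  | zero => simp
  | tmul f g => simp [aux]
  | add x y hx hy => simp only [map_add, LinearMap.add_apply, hx, hy]

theorem tensorEquiv₃_lTensor [Module.Finite k H] (t : HopfDual k H ⊗[k] HopfDual k H)
    (a b c : H) :
    tensorEquiv₃ k H ((comulMap k H).lTensor _ t) (a ⊗ₜ (b ⊗ₜ c)) =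
      tensorEquiv k H t (a ⊗ₜ (b * c)) := by
  induction t with
  | zero => simp
  | tmul f g => simp
  | add x y hx hy => simp only [map_add, LinearMap.add_apply, hx, hy]

instance instCoalgebra [Module.Finite k H] : Coalgebra k (HopfDual k H) where
  comul := comulMap k H
  counit := counitMap k H
  coassoc := by
    refine LinearMap.ext fun f ↦ tensor_ext₃ fun a b c ↦ ?_
    simp [tensorEquiv₃_assoc, tensorEquiv₃_lTensor, mul_assoc]
  rTensor_counit_comp_comul := by
    refine LinearMap.ext fun f ↦ (TensorProduct.lid k _).injective ?_
    have aux (t : HopfDual k H ⊗[k] HopfDual k H) (a : H) :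
        (TensorProduct.lid k _ ((counitMap k H).rTensor _ t)) a =
          tensorEquiv k H t (1 ⊗ₜ a) := by
      induction t with
      | zero => simp
      | tmul f g => simp
      | add x y hx hy => simp only [map_add, LinearMap.add_apply, hx, hy]
    ext a
    simp [aux]
  lTensor_counit_comp_comul := by
    refine LinearMap.ext fun f ↦ (TensorProduct.rid k _).injective ?_
    have aux (t : HopfDual k H ⊗[k] HopfDual k H) (a : H) :
        (TensorProduct.rid k _ ((counitMap k H).lTensor _ t)) a =
          tensorEquiv k H t (a ⊗ₜ 1) := by
      induction t with
      | zero => simp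
      | tmul f g => simp [mul_comm]
      | add x y hx hy => simp only [map_add, LinearMap.add_apply, hx, hy]
    ext a
    simp [aux]

theorem comul_def [Module.Finite k H] (f : HopfDual k H) :
    comul (R := k) f = comulMap k H f := rfl

theorem counit_def [Module.Finite k H] (f : HopfDual k H) :
    counit (R := k) f = f 1 := rfl

theorem tensorEquiv_mul [Module.Finite k H] (s t : HopfDual k H ⊗[k] HopfDual k H) {ι κ : Type*}
    {a b : H} (ra : Coalgebra.Repr k a ι) (rb : Coalgebra.Repr k b κ) :
    tensorEquiv k H (s * t) (a ⊗ₜ b) = ∑ i ∈ ra.index, ∑ j ∈ rb.index,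
      tensorEquiv k H s (ra.left i ⊗ₜ rb.left j) * tensorEquiv k H t (ra.right i ⊗ₜ rb.right j) := by
  induction s with
  | zero => simp
  | add x y hx hy => simp only [add_mul, map_add, LinearMap.add_apply, hx, hy,
      Finset.sum_add_distrib]
  | tmul f g =>
    induction t with
    | zero => simp
    | add x y hx hy => simp only [mul_add, map_add, LinearMap.add_apply, hx, hy,
        Finset.sum_add_distrib]
    | tmul f' g' =>
      rw [Algebra.TensorProduct.tmul_mul_tmul, tensorEquiv_tmul, mul_repr _ _ ra,
        mul_repr _ _ rb, Finset.sum_mul_sum]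
      refine Finset.sum_congr rfl fun i _ ↦ Finset.sum_congr rfl fun j _ ↦ ?_
      simp only [tensorEquiv_tmul]
      ring

theorem comulMap_mul [Module.Finite k H] (f g : HopfDual k H) :
    comulMap k H (f * g) = comulMap k H f * comulMap k H g := by
  refine tensor_ext fun a b ↦ ?_
  rw [tensorEquiv_mul _ _ (ℛ k a) (ℛ k b), tensorEquiv_comulMap, mul_def, Bialgebra.comul_mul]
  conv_lhs => rw [← (ℛ k a).eq, ← (ℛ k b).eq]
  simp [Finset.sum_mul_sum]

instance instBialgebra [Module.Finite k H] : Bialgebra k (HopfDual k H) :=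
  Bialgebra.mk' k (HopfDual k H)
    (by simp [counit_def])
    (by intro f g; simp [counit_def, mul_def, Algebra.TensorProduct.one_def])
    (by
      refine tensor_ext fun a b ↦ ?_
      simp [comul_def, Algebra.TensorProduct.one_def])
    (by intro f g; exact comulMap_mul f g)

theorem mul'_apply [Module.Finite k H] (t : HopfDual k H ⊗[k] HopfDual k H) (a : H) :
    (LinearMap.mul' k (HopfDual k H) t) a = tensorEquiv k H t (comul a) := by
  induction t with
  | zero => simp
  | add x y hx hy => simp only [map_add, LinearMap.add_apply, hx, hy]
  | tmul f g =>
    rw [LinearMap.mul'_apply, mul_repr _ _ (ℛ k a)]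
    conv_rhs => rw [← (ℛ k a).eq]
    simp

instance instHopfAlgebra [Module.Finite k H] : HopfAlgebra k (HopfDual k H) where
  antipode := antipodeMap k H
  mul_antipode_rTensor_comul := by
    refine LinearMap.ext fun f ↦ ?_
    have aux (t : HopfDual k H ⊗[k] HopfDual k H) (a b : H) :
        tensorEquiv k H ((antipodeMap k H).rTensor _ t) (a ⊗ₜ b) =
          tensorEquiv k H t (HopfAlgebra.antipode k a ⊗ₜ b) := by
      induction t with
      | zero => simp
      | tmul f g => simp
      | add x y hx hy => simp only [map_add, LinearMap.add_apply, hx, hy]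
    ext a
    simp only [LinearMap.comp_apply, mul'_apply]
    rw [← (ℛ k a).eq]
    simp only [map_sum, aux, comul_def, tensorEquiv_comulMap]
    rw [← map_sum, HopfAlgebra.sum_antipode_mul_eq_smul]
    simp [counit_def, mul_comm]
  mul_antipode_lTensor_comul := by
    refine LinearMap.ext fun f ↦ ?_
    have aux (t : HopfDual k H ⊗[k] HopfDual k H) (a b : H) :
        tensorEquiv k H ((antipodeMap k H).lTensor _ t) (a ⊗ₜ b) =
          tensorEquiv k H t (a ⊗ₜ HopfAlgebra.antipode k b) := by
      induction t with
      | zero => simp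
      | tmul f g => simp
      | add x y hx hy => simp only [map_add, LinearMap.add_apply, hx, hy]
    ext a
    simp only [LinearMap.comp_apply, mul'_apply]
    rw [← (ℛ k a).eq]
    simp only [map_sum, aux, comul_def, tensorEquiv_comulMap]
    rw [← map_sum, HopfAlgebra.sum_mul_antipode_eq_smul]
    simp [counit_def, mul_comm]

end HopfDual

/-! ### Restricted Lie algebras -/

/-- The term `s_r(x₀, x₁) = -(1/r) ∑_u ad x_{u(1)} ∘ ⋯ ∘ ad x_{u(p-1)} (x₁)`, the sum being over
all maps `u : {1, …, p-1} → {0, 1}` that take the value `0` exactly `r` times. -/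
def jacobsonTerm (p : ℕ) (k : Type*) {L : Type*} [Field k] [LieRing L] [LieAlgebra k L]
    (r : ℕ) (x₀ x₁ : L) : L :=
  -((r : k)⁻¹ • ∑ u : Fin (p - 1) → Fin 2 with (Finset.univ.filter (u · = 0)).card = r,
    (List.ofFn fun j ↦ LieAlgebra.ad k L (![x₀, x₁] (u j))).prod x₁)

/-- A restricted Lie algebra (or `p`-Lie algebra) over a field `k` of characteristic `p`: a Lie
algebra together with a `p`-map `x ↦ x^[p]`. -/
class RestrictedLieAlgebra (p : ℕ) (k L : Type*) [Field k] [LieRing L] [LieAlgebra k L] where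
  pMap : L → L
  ad_pMap (x : L) : LieAlgebra.ad k L (pMap x) = LieAlgebra.ad k L x ^ p
  pMap_smul (a : k) (x : L) : pMap (a • x) = a ^ p • pMap x
  pMap_add (x₀ x₁ : L) : pMap (x₀ + x₁) =
    pMap x₀ + pMap x₁ + ∑ r ∈ Finset.Icc 1 (p - 1), jacobsonTerm p k r x₀ x₁

/-- A restricted Lie algebra is simple if it is nonzero and has no ideal closed under the `p`-map
other than `0` and itself. -/
structure IsSimpleRestricted (p : ℕ) (k L : Type*) [Field k] [LieRing L] [LieAlgebra k L]
    [RestrictedLieAlgebra p k L] : Prop where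
  nontrivial : Nontrivial L
  eq_bot_or_eq_top (I : LieIdeal k L)
    (hI : ∀ x ∈ I, RestrictedLieAlgebra.pMap p k x ∈ I) : I = ⊥ ∨ I = ⊤

/-! ### The restricted enveloping algebra -/

/-- The relations `x ^ p = x^[p]`, for `x` in `L`, in the universal enveloping algebra. -/
inductive RestrictedEnvelopingAlgebra.Rel (p : ℕ) (k L : Type*) [Field k] [LieRing L]
    [LieAlgebra k L] [RestrictedLieAlgebra p k L] :
    UniversalEnvelopingAlgebra k L → UniversalEnvelopingAlgebra k L → Prop
  | pow (x : L) : Rel p k L (UniversalEnvelopingAlgebra.ι k x ^ p)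
      (UniversalEnvelopingAlgebra.ι k (RestrictedLieAlgebra.pMap p k x))

/-- The restricted enveloping algebra `U(L) / (x ^ p - x^[p])`. -/
abbrev RestrictedEnvelopingAlgebra (p : ℕ) (k L : Type*) [Field k] [LieRing L]
    [LieAlgebra k L] [RestrictedLieAlgebra p k L] : Type _ :=
  RingQuot (RestrictedEnvelopingAlgebra.Rel p k L)

namespace RestrictedEnvelopingAlgebra

attribute [local instance 100] LieRing.ofAssociativeRing

variable (p : ℕ) (k : Type*) {L : Type*} [Field k] [LieRing L] [LieAlgebra k L]
  [RestrictedLieAlgebra p k L]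

/-- The canonical map from `L` to its restricted enveloping algebra. -/
def ι : L →ₗ[k] RestrictedEnvelopingAlgebra p k L :=
  (RingQuot.mkAlgHom k (Rel p k L)).toLinearMap ∘ₗ
    (UniversalEnvelopingAlgebra.ι k : L →ₗ⁅k⁆ UniversalEnvelopingAlgebra k L).toLinearMap

theorem ι_lie (x y : L) : ι p k ⁅x, y⁆ = ι p k x * ι p k y - ι p k y * ι p k x := by
  simp only [ι, LinearMap.comp_apply, LieHom.coe_toLinearMap, LieHom.map_lie,
    LieRing.of_associative_ring_bracket, AlgHom.toLinearMap_apply, map_sub, map_mul]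

theorem ι_pow (x : L) : ι p k x ^ p = ι p k (RestrictedLieAlgebra.pMap p k x) := by
  simp only [ι, LinearMap.comp_apply, LieHom.coe_toLinearMap, AlgHom.toLinearMap_apply]
  rw [← map_pow]
  exact RingQuot.mkAlgHom_rel k (Rel.pow x)

variable {p k} {A : Type*} [Ring A] [Algebra k A]

/-- The universal property of the restricted enveloping algebra. -/
def lift (f : L →ₗ[k] A) (hlie : ∀ x y, f ⁅x, y⁆ = f x * f y - f y * f x)
    (hpow : ∀ x, f x ^ p = f (RestrictedLieAlgebra.pMap p k x)) :
    RestrictedEnvelopingAlgebra p k L →ₐ[k] A :=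
  RingQuot.liftAlgHom k ⟨UniversalEnvelopingAlgebra.lift k
    { toLinearMap := f
      map_lie' := fun {x y} ↦ by
        simpa [LieRing.of_associative_ring_bracket] using hlie x y }, by
    rintro _ _ ⟨x⟩
    rw [map_pow, UniversalEnvelopingAlgebra.lift_ι_apply, UniversalEnvelopingAlgebra.lift_ι_apply]
    exact hpow x⟩

@[simp]
theorem lift_ι (f : L →ₗ[k] A) (hlie : ∀ x y, f ⁅x, y⁆ = f x * f y - f y * f x)
    (hpow : ∀ x, f x ^ p = f (RestrictedLieAlgebra.pMap p k x)) (x : L) :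
    lift f hlie hpow (ι p k x) = f x := by
  simp only [lift, ι, LinearMap.comp_apply, LieHom.coe_toLinearMap, AlgHom.toLinearMap_apply,
    RingQuot.liftAlgHom_mkAlgHom_apply, UniversalEnvelopingAlgebra.lift_ι_apply]
  rfl

theorem hom_ext {f g : RestrictedEnvelopingAlgebra p k L →ₐ[k] A}
    (h : ∀ x : L, f (ι p k x) = g (ι p k x)) : f = g := by
  apply RingQuot.ringQuot_ext'
  apply UniversalEnvelopingAlgebra.hom_ext
  ext x
  exact h x

theorem mem_of_ι_mem (S : Subalgebra k (RestrictedEnvelopingAlgebra p k L))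
    (hι : ∀ x : L, ι p k x ∈ S) (y : RestrictedEnvelopingAlgebra p k L) : y ∈ S := by
  let φ : RestrictedEnvelopingAlgebra p k L →ₐ[k] S :=
    lift (LinearMap.codRestrict (Subalgebra.toSubmodule S) (ι p k) hι)
      (fun x y ↦ Subtype.ext (ι_lie p k x y)) (fun x ↦ Subtype.ext (ι_pow p k x))
  have hφ : S.val.comp φ = AlgHom.id k _ := hom_ext fun x ↦ by
    simp only [φ, AlgHom.comp_apply, lift_ι]
    rfl
  have h1 : (φ y : RestrictedEnvelopingAlgebra p k L) = y := congr($hφ y)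
  rw [← h1]
  exact (φ y).2

/-- Every element is a linear combination of products of elements of `L`. -/
theorem induction {P : RestrictedEnvelopingAlgebra p k L → Prop}
    (one : P 1) (ι_mul : ∀ x y, P y → P (ι p k x * y)) (add : ∀ x y, P x → P y → P (x + y))
    (smul : ∀ (c : k) x, P x → P (c • x)) (y : RestrictedEnvelopingAlgebra p k L) : P y := by
  let S : Subalgebra k (RestrictedEnvelopingAlgebra p k L) :=
    { carrier := {z | ∀ y, P y → P (z * y)}
      mul_mem' := fun {a b} ha hb y hy ↦ by rw [mul_assoc]; exact ha _ (hb _ hy)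
      add_mem' := fun {a b} ha hb y hy ↦ by rw [add_mul]; exact add _ _ (ha _ hy) (hb _ hy)
      algebraMap_mem' := fun c y hy ↦ by rw [← Algebra.smul_def]; exact smul _ _ hy }
  have h : y ∈ S := mem_of_ι_mem S ι_mul y
  simpa using h 1 one

variable (p k L)

/-- The subspace spanned by `1` and the image of `L`. -/
def gens : Submodule k (RestrictedEnvelopingAlgebra p k L) := 1 ⊔ LinearMap.range (ι p k)

variable {L}

theorem one_le_gens : 1 ≤ gens p k L := le_sup_left

theorem ι_mem_gens (x : L) : ι p k x ∈ gens p k L :=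
  Submodule.mem_sup_right (LinearMap.mem_range_self _ x)

theorem gens_pow_mono : Monotone fun n ↦ gens p k L ^ n := by
  refine monotone_nat_of_le_succ fun n ↦ ?_
  calc gens p k L ^ n = gens p k L ^ n * 1 := (mul_one _).symm
    _ ≤ gens p k L ^ n * gens p k L := mul_le_mul_right (one_le_gens p k) _
    _ = gens p k L ^ (n + 1) := (pow_succ _ _).symm

theorem prod_mem_gens_pow (l : List L) : (l.map (ι p k)).prod ∈ gens p k L ^ l.length := by
  induction l with
  | nil => simpa using ⟨1, map_one _⟩
  | cons x l ih =>
    rw [List.map_cons, List.prod_cons, List.length_cons, pow_succ']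
    exact Submodule.mul_mem_mul (ι_mem_gens p k x) ih

theorem perm_sub_mem {l l' : List L} (h : l.Perm l') :
    (l.map (ι p k)).prod - (l'.map (ι p k)).prod ∈ gens p k L ^ (l.length - 1) := by
  induction h with
  | nil => simp
  | @cons x l l' h ih =>
    rcases l with _ | ⟨y, l⟩
    · obtain rfl : l' = [] := by simpa using h
      simp
    · rw [List.map_cons, List.prod_cons, List.map_cons (l := l'), List.prod_cons, ← mul_sub]
      have : (x :: y :: l).length - 1 = ((y :: l).length - 1) + 1 := by simp
      rw [this, pow_succ']
      exact Submodule.mul_mem_mul (ι_mem_gens p k x) ih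
  | swap x y l =>
    have : (y :: x :: l).length - 1 = l.length + 1 := by simp
    simp only [List.map_cons, List.prod_cons]
    rw [this, pow_succ', ← mul_assoc, ← mul_assoc, ← sub_mul, ← ι_lie]
    exact Submodule.mul_mem_mul (ι_mem_gens p k _) (prod_mem_gens_pow p k l)
  | @trans l₁ l₂ l₃ h₁ h₂ ih₁ ih₂ =>
    rw [← h₁.length_eq] at ih₂
    simpa using add_mem ih₁ ih₂

/-- The restricted enveloping algebra of a finite-dimensional Lie algebra is finite-dimensional. -/
instance instFinite [Fact p.Prime] [Module.Finite k L] :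
    Module.Finite k (RestrictedEnvelopingAlgebra p k L) := by
  classical
  let b := Module.finBasis k L
  set d := Module.finrank k L
  set N := d * (p - 1)
  have hp : 2 ≤ p := (Fact.out : p.Prime).two_le
  -- products of basis vectors of length `N + 1` lie in lower filtration degree
  have key (l : List (Fin d)) (hl : l.length = N + 1) :
      (l.map fun i ↦ ι p k (b i)).prod ∈ gens p k L ^ N := by
    obtain ⟨i, hi⟩ : ∃ i, p ≤ l.count i := by
      by_contra! h
      have h1 : l.length = ∑ i : Fin d, l.count i := by
        simpa using (Multiset.sum_count_eq_card (s := Finset.univ) (m := (l : Multiset (Fin d)))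
          (by simp)).symm
      have h2 : ∑ i : Fin d, l.count i ≤ ∑ _i : Fin d, (p - 1) :=
        Finset.sum_le_sum fun i _ ↦ by have := h i; omega
      simp only [Finset.sum_const, Finset.card_univ, Fintype.card_fin, smul_eq_mul] at h2
      omega
    have hsub : (List.replicate p i).Subperm l := by
      rw [List.subperm_ext_iff]
      intro j hj
      obtain rfl := List.eq_of_mem_replicate hj
      simpa using hi
    obtain ⟨l', hl'⟩ : ∃ l', l.Perm (List.replicate p i ++ l') :=
      ⟨l.diff (List.replicate p i), (List.subperm_append_diff_self_of_count_le
        (List.subperm_ext_iff.mp hsub)).symm⟩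
    have hlen : p + l'.length = N + 1 := by
      have := hl'.length_eq
      simp at this
      omega
    have h1 := perm_sub_mem p k (hl'.map b)
    have h2 : (((List.replicate p i ++ l').map b).map (ι p k)).prod ∈ gens p k L ^ N := by
      rw [List.map_append, List.map_append, List.prod_append, List.map_replicate,
        List.map_replicate, List.prod_replicate, ι_pow]
      have h3 := prod_mem_gens_pow p k (RestrictedLieAlgebra.pMap p k (b i) :: l'.map b)
      rw [List.map_cons, List.prod_cons] at h3
      refine gens_pow_mono p k ?_ h3
      simp
      omega
    have h4 := add_mem (by simpa [hl] using h1) h2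
    simpa [Function.comp_def] using h4
  have hgens : gens p k L = Submodule.span k (Set.range (fun o : Option (Fin d) ↦
      o.elim 1 fun i ↦ ι p k (b i))) := by
    rw [gens, Submodule.one_eq_span, LinearMap.range_eq_map, ← b.span_eq, Submodule.map_span,
      ← Submodule.span_union]
    congr 1
    ext y
    simp [Option.exists, eq_comm]
  have hstep : gens p k L ^ (N + 1) ≤ gens p k L ^ N := by
    conv_lhs => rw [hgens, Submodule.span_pow]
    rw [Submodule.span_le]
    intro y hy
    obtain ⟨f, rfl⟩ := Set.mem_pow.mp hy
    choose g hg using fun i ↦ (f i).2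
    have h1 (l : List (Option (Fin d))) :
        (l.map fun o ↦ o.elim (1 : RestrictedEnvelopingAlgebra p k L) fun i ↦ ι p k (b i)).prod =
          (l.reduceOption.map fun i ↦ ι p k (b i)).prod := by
      induction l with
      | nil => simp
      | cons o l ih => cases o <;> simp [ih]
    have h2 : (List.ofFn fun i ↦ ((f i : RestrictedEnvelopingAlgebra p k L))) =
        (List.ofFn g).map fun o ↦ o.elim 1 fun i ↦ ι p k (b i) := by
      rw [List.map_ofFn]
      congr 1
      funext i
      exact (hg i).symm
    rw [h2, h1, SetLike.mem_coe]
    have hlen := List.reduceOption_length_le (List.ofFn g)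
    rw [List.length_ofFn] at hlen
    rcases hlen.eq_or_lt with h | h
    · exact key _ h
    · have h3 := prod_mem_gens_pow p k ((List.ofFn g).reduceOption.map b)
      rw [List.map_map, List.length_map] at h3
      exact gens_pow_mono p k (Nat.lt_succ_iff.mp h) h3
  have hpow (n : ℕ) : gens p k L ^ n ≤ gens p k L ^ N := by
    induction n with
    | zero => exact gens_pow_mono p k (Nat.zero_le N)
    | succ n ih =>
      calc gens p k L ^ (n + 1) = gens p k L ^ n * gens p k L := pow_succ _ _
        _ ≤ gens p k L ^ N * gens p k L := mul_le_mul_left ih _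
        _ = gens p k L ^ (N + 1) := (pow_succ _ _).symm
        _ ≤ gens p k L ^ N := hstep
  have hone : (1 : RestrictedEnvelopingAlgebra p k L) ∈ gens p k L ^ N :=
    gens_pow_mono p k (Nat.zero_le N) (by simpa using ⟨1, map_one _⟩)
  let S : Subalgebra k (RestrictedEnvelopingAlgebra p k L) :=
    (gens p k L ^ N).toSubalgebra hone fun x y hx hy ↦
      hpow (N + N) (by rw [pow_add]; exact Submodule.mul_mem_mul hx hy)
  have hι (x : L) : ι p k x ∈ S := hpow 1 (by rw [pow_one]; exact ι_mem_gens p k x)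
  have htop : gens p k L ^ N = ⊤ := eq_top_iff.mpr fun y _ ↦ mem_of_ι_mem S hι y
  rw [Module.finite_def, ← htop, hgens]
  exact Submodule.FG.pow (Submodule.fg_span (Set.finite_range _)) N

/-! The Hopf algebra structure for which the elements of `L` are primitive. -/

/-- The comultiplication, `x ↦ x ⊗ 1 + 1 ⊗ x` for `x` in `L`. -/
def comulHom [Fact p.Prime] [CharP k p] : RestrictedEnvelopingAlgebra p k L →ₐ[k]
    RestrictedEnvelopingAlgebra p k L ⊗[k] RestrictedEnvelopingAlgebra p k L :=
  lift ((TensorProduct.mk k _ _).flip 1 ∘ₗ ι p k + TensorProduct.mk k _ _ 1 ∘ₗ ι p k)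
    (fun x y ↦ by
      simp [ι_lie, mul_add, add_mul, TensorProduct.tmul_sub]
      abel)
    (fun x ↦ by
      rcases subsingleton_or_nontrivial
        (RestrictedEnvelopingAlgebra p k L ⊗[k] RestrictedEnvelopingAlgebra p k L)
      · exact Subsingleton.elim _ _
      have : CharP (RestrictedEnvelopingAlgebra p k L ⊗[k] RestrictedEnvelopingAlgebra p k L) p :=
        charP_of_injective_algebraMap (algebraMap k _).injective p
      have hc : Commute (ι p k x ⊗ₜ[k] (1 : RestrictedEnvelopingAlgebra p k L))
          ((1 : RestrictedEnvelopingAlgebra p k L) ⊗ₜ[k] ι p k x) := by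
        simp [commute_iff_eq]
      simp [add_pow_char_of_commute _ hc, ι_pow])

/-- The counit, `x ↦ 0` for `x` in `L`. -/
def counitHom [Fact p.Prime] : RestrictedEnvelopingAlgebra p k L →ₐ[k] k :=
  lift 0 (by simp) (by simp [(Fact.out : p.Prime).ne_zero])

/-- The antipode, `x ↦ -x` for `x` in `L`, as a homomorphism to the opposite algebra. -/
def antipodeHom [Fact p.Prime] [CharP k p] :
    RestrictedEnvelopingAlgebra p k L →ₐ[k] (RestrictedEnvelopingAlgebra p k L)ᵐᵒᵖ :=
  lift (-((MulOpposite.opLinearEquiv k).toLinearMap ∘ₗ ι p k))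
    (fun x y ↦ by simp [ι_lie, ← MulOpposite.op_mul])
    (fun x ↦ by
      rcases subsingleton_or_nontrivial (RestrictedEnvelopingAlgebra p k L)
      · exact Subsingleton.elim _ _
      have : CharP (RestrictedEnvelopingAlgebra p k L)ᵐᵒᵖ p :=
        charP_of_injective_algebraMap (algebraMap k _).injective p
      have h : (-1 : (RestrictedEnvelopingAlgebra p k L)ᵐᵒᵖ) ^ p = -1 := by
        have := add_pow_char_of_commute (p := p)
          (Commute.one_left (-1 : (RestrictedEnvelopingAlgebra p k L)ᵐᵒᵖ))
        rw [add_neg_cancel, zero_pow (Fact.out : p.Prime).ne_zero, one_pow] at this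
        exact (neg_eq_of_add_eq_zero_right this.symm).symm
      rw [LinearMap.neg_apply, neg_pow, h]
      simp [← MulOpposite.op_pow, ι_pow])

@[simp]
theorem counitHom_ι [Fact p.Prime] (x : L) : counitHom p k (ι p k x) = 0 := by
  simp [counitHom]

variable [Fact p.Prime] [CharP k p]

@[simp]
theorem comulHom_ι (x : L) : comulHom p k (ι p k x) = ι p k x ⊗ₜ 1 + 1 ⊗ₜ ι p k x := by
  simp [comulHom]

@[simp]
theorem antipodeHom_ι (x : L) : antipodeHom p k (ι p k x) = MulOpposite.op (-ι p k x) := by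
  simp [antipodeHom]

instance instBialgebra : Bialgebra k (RestrictedEnvelopingAlgebra p k L) :=
  Bialgebra.ofAlgHom (comulHom p k) (counitHom p k)
    (hom_ext fun x ↦ by
      simp [Algebra.TensorProduct.one_def, TensorProduct.add_tmul, TensorProduct.tmul_add,
        add_assoc])
    (hom_ext fun x ↦ by simp)
    (hom_ext fun x ↦ by simp)

open Coalgebra

theorem comul_ι (x : L) : comul (R := k) (ι p k x) = ι p k x ⊗ₜ 1 + 1 ⊗ₜ ι p k x :=
  comulHom_ι p k x

theorem counit_ι (x : L) : counit (R := k) (ι p k x) = 0 :=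
  counitHom_ι p k x

instance instIsCocomm : IsCocomm k (RestrictedEnvelopingAlgebra p k L) where
  comm_comp_comul := by
    have : ((Algebra.TensorProduct.comm k _ _).toAlgHom.comp (comulHom p k) :
        RestrictedEnvelopingAlgebra p k L →ₐ[k] _) = comulHom p k :=
      hom_ext fun x ↦ by simp [add_comm]
    exact congr(($this).toLinearMap)

instance instHopfAlgebra : HopfAlgebra k (RestrictedEnvelopingAlgebra p k L) where
  antipode := (MulOpposite.opLinearEquiv k).symm.toLinearMap ∘ₗ (antipodeHom p k).toLinearMap
  mul_antipode_rTensor_comul := by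
    set S : RestrictedEnvelopingAlgebra p k L →ₗ[k] RestrictedEnvelopingAlgebra p k L :=
      (MulOpposite.opLinearEquiv k).symm.toLinearMap ∘ₗ (antipodeHom p k).toLinearMap with hS
    have aux (x : L) (t : RestrictedEnvelopingAlgebra p k L ⊗[k] RestrictedEnvelopingAlgebra p k L) :
        LinearMap.mul' k _ (S.rTensor _ ((ι p k x ⊗ₜ 1 + 1 ⊗ₜ ι p k x) * t)) = 0 := by
      induction t with
      | zero => simp
      | tmul a b => simp [hS, add_mul, mul_assoc]
      | add s t hs ht => rw [mul_add, map_add, map_add, hs, ht, add_zero]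
    refine LinearMap.ext fun y ↦ ?_
    simp only [LinearMap.comp_apply]
    induction y using induction with
    | one => simp [hS, Algebra.TensorProduct.one_def]
    | ι_mul x y _ =>
      rw [Bialgebra.comul_mul, comul_ι, aux, Bialgebra.counit_mul, counit_ι, zero_mul, map_zero]
    | add x y hx hy => simp only [map_add, hx, hy]
    | smul c x hx => simp only [map_smul, hx]
  mul_antipode_lTensor_comul := by
    set S : RestrictedEnvelopingAlgebra p k L →ₗ[k] RestrictedEnvelopingAlgebra p k L :=
      (MulOpposite.opLinearEquiv k).symm.toLinearMap ∘ₗ (antipodeHom p k).toLinearMap with hS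
    have aux (x : L) (t : RestrictedEnvelopingAlgebra p k L ⊗[k] RestrictedEnvelopingAlgebra p k L) :
        LinearMap.mul' k _ (S.lTensor _ ((ι p k x ⊗ₜ 1 + 1 ⊗ₜ ι p k x) * t)) =
          ι p k x * LinearMap.mul' k _ (S.lTensor _ t) -
            LinearMap.mul' k _ (S.lTensor _ t) * ι p k x := by
      induction t with
      | zero => simp
      | tmul a b => simp [hS, add_mul, mul_assoc, sub_eq_add_neg]
      | add s t hs ht =>
        rw [mul_add, map_add, map_add, hs, ht, map_add, map_add, mul_add, add_mul]
        abel
    refine LinearMap.ext fun y ↦ ?_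
    simp only [LinearMap.comp_apply]
    induction y using induction with
    | one => simp [hS, Algebra.TensorProduct.one_def]
    | ι_mul x y hy =>
      rw [Bialgebra.comul_mul, comul_ι, aux, hy, Bialgebra.counit_mul, counit_ι, zero_mul,
        map_zero, Algebra.linearMap_apply, Algebra.commutes, sub_self]
    | add x y hx hy => simp only [map_add, hx, hy]
    | smul c x hx => simp only [map_smul, hx]

end RestrictedEnvelopingAlgebra

/-! ### Finite group schemes -/

open Opposite

/-- A group scheme `G` over a field `k` is simple if it is not the trivial group scheme `Spec k`
and each of its closed normal subgroup schemes is either trivial or all of `G`. -/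
structure IsSimpleGroupScheme {k : Type u} [Field k] (G : Grp (Over (Spec (.of k)))) : Prop where
  nontrivial : ¬ IsIso G.X.hom
  eq_bot_or_eq_top (N : Grp (Over (Spec (.of k)))) (i : N ⟶ G)
    (closed : IsClosedImmersion i.hom.hom.left) (normal : IsMonHom.Normal i.hom.hom) :
    IsIso N.X.hom ∨ IsIso i

/-- The constant group scheme over `k` attached to a finite group `Γ`: the spectrum of the Hopf
algebra of functions `Γ → k`, which is the dual of the group algebra of `Γ`. -/
def constantGroupScheme (k Γ : Type u) [Field k] [Group Γ] [Finite Γ] :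
    Grp (Over (Spec (.of k))) :=
  (hopfSpec (.of k)).obj (op (.of k (HopfDual k (MonoidAlgebra k Γ))))

/-- The finite group scheme of height one over `k` attached to a restricted Lie algebra `L`: the
spectrum of the dual of the restricted enveloping Hopf algebra of `L`. -/
def heightOneGroupScheme (p : ℕ) [Fact p.Prime] (k L : Type u) [Field k] [CharP k p] [LieRing L]
    [LieAlgebra k L] [Module.Finite k L] [RestrictedLieAlgebra p k L] :
    Grp (Over (Spec (.of k))) :=
  (hopfSpec (.of k)).obj (op (.of k (HopfDual k (RestrictedEnvelopingAlgebra p k L))))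

end

/-!
Write `G = Spec A` with `A` a finite-dimensional commutative Hopf algebra, `I` its augmentation
ideal and `A*` the dual Hopf algebra. A normal Hopf ideal of `A`, meaning a Hopf ideal `K` such that
the coaction `conjHom` dual to conjugation sends `K` into the kernel of `A ⊗ A → A ⊗ A/K`, defines a
closed normal subgroup scheme, so simplicity of `G` forces `K = 0` or `K = I`
(`isSimpleHopf_of_isSimpleGroupScheme`).

The ideal generated by the `p`-th powers of the elements of `I` is such an ideal: it defines the
kernel of the Frobenius morphism (`frobeniusIdeal_normal`). Hence there are two cases.

* If it is `I`, then `I = I²`, so `I` is generated by an idempotent. Translating this idempotent to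
  the other `k`-points shows that the points of `G` separate the elements of `A`
  (`eq_zero_of_forall_point`). The points are group-like elements of `A*`, and `A*` is the group
  algebra of the group `Γ` of its group-like elements (`bijective_liftGroupLikeBialgHom`).
* If it is `0`, then `a ^ p = 0` for all `a ∈ I`. Let `L` be the restricted Lie algebra of primitive
  elements of `A*` and `n` its dimension; `L` is the dual of `I/I²`. Elements of `I` lifting a basis
  of `I/I²` generate `A`, so `dim A ≤ p ^ n`. Primitive elements act on `A` by derivations, and
  evaluating ordered monomials in a basis of `L`, with exponents below `p`, on monomials in the
  generators of `A` gives a triangular matrix; so those `p ^ n` monomials are linearly independent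
  (`HopfDual.IsDualSystem.linearIndependent`). The easy half of the Poincaré-Birkhoff-Witt theorem
  gives `dim u(L) ≤ p ^ n`, and therefore the restricted enveloping algebra `u(L)` maps
  isomorphically onto `A*` (`RestrictedEnvelopingAlgebra.bijective_liftPrimitives`).

That `p`-th powers make `L` a restricted Lie algebra is Jacobson's formula, obtained by computing
the derivative of `(x₀ X + x₁) ^ p` over the polynomial ring (`add_pow_eq_jacobson`).

Simplicity of `Γ` and of `L` comes from duality: the annihilator in `A` of a subalgebra of `A*`
closed under comultiplication, antipode and adjoint action is a normal Hopf ideal, so the subalgebra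
is `k` or `A*` (`IsSimpleHopf.adjoin_eq_bot_or_eq_top`). It is applied to the subalgebras generated
by a normal subgroup of `Γ` and by a restricted ideal of `L`.
-/

noncomputable section

/-! ### Normal Hopf ideals and closed normal subgroup schemes -/

section NormalHopfIdeals

open Opposite MonoidalCategory CartesianMonoidalCategory MonObj GrpObj WithConv

open scoped Obj

/-- A monoidal functor preserves normal morphisms of group objects, as long as the image of the
morphism is a monomorphism. -/
theorem CategoryTheory.IsMonHom.Normal.map {C D : Type*} [Category* C] [Category* D]
    [CartesianMonoidalCategory C] [CartesianMonoidalCategory D] (F : C ⥤ D) [F.Monoidal]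
    {G H : C} [GrpObj G] [GrpObj H] (φ : H ⟶ G) [hφ : IsMonHom.Normal φ] [Mono (F.map φ)] :
    IsMonHom.Normal (F.map φ) where
  mono := inferInstance
  exists_comp_eq_conj := by
    obtain ⟨ψ, hψ⟩ := hφ.exists_comp_eq_conj
    refine ⟨Functor.LaxMonoidal.μ F G H ≫ F.map ψ, ?_⟩
    have h1 : G ◁ φ ≫ conj G = fst G H * (snd G H ≫ φ) * (fst G H)⁻¹ := by
      simp [conj, comp_mul, comp_inv]
    have h2 : F.obj G ◁ F.map φ ≫ conj (F.obj G) =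
        fst _ _ * (snd _ _ ≫ F.map φ) * (fst _ _)⁻¹ := by
      simp [conj, comp_mul, comp_inv]
    rw [Category.assoc, ← F.map_comp, hψ, h1, h2]
    have h3 : F.map (fst G H * (snd G H ≫ φ) * (fst G H)⁻¹) = F.map (fst G H) *
        F.map (snd G H ≫ φ) * (F.map (fst G H))⁻¹ := by
      have := map_inv (F.homMonoidHom (X := G ⊗ H) (M := G)) (fst G H)
      simp only [Functor.homMonoidHom_apply] at this
      rw [F.map_mul, F.map_mul, this]
    rw [h3]
    simp only [comp_mul, comp_inv, F.map_comp]
    simp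

variable {k A : Type u} [Field k] [CommRing A] [HopfAlgebra k A]

variable (k A) in
/-- The coaction of `A` on itself dual to the conjugation `(g, h) ↦ g * h * g⁻¹`. -/
def conjHom : A →ₐ[k] A ⊗[k] A :=
  (toConv Algebra.TensorProduct.includeLeft * toConv Algebra.TensorProduct.includeRight *
    toConv (Algebra.TensorProduct.includeLeft.comp (HopfAlgebra.antipodeAlgHom k A)) :
    WithConv (A →ₐ[k] A ⊗[k] A)).ofConv

theorem CommAlgCat.unop_hom_mul {S : (CommAlgCat.{u} k)ᵒᵖ} (f g : S ⟶ op (CommAlgCat.of k A)) :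
    (f * g).unop.hom =
      (toConv f.unop.hom * toConv g.unop.hom : WithConv (A →ₐ[k] S.unop)).ofConv := by
  rw [Hom.mul_def]
  ext a
  exact (AlgHom.convMul_apply (toConv f.unop.hom)
    (toConv g.unop.hom : WithConv (A →ₐ[k] S.unop)) a).symm

theorem CommAlgCat.unop_hom_inv {S : (CommAlgCat.{u} k)ᵒᵖ} (f : S ⟶ op (CommAlgCat.of k A)) :
    (f⁻¹).unop.hom = f.unop.hom.comp (HopfAlgebra.antipodeAlgHom k A) := by
  rw [Hom.inv_def]
  rfl

variable (K : Ideal A)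

/-- In the opposite of the category of commutative algebras, the closed subgroup cut out by a Hopf
ideal stable under the conjugation coaction is normal. -/
theorem normal_op_ofHom_mkₐ [K.IsHopfIdeal k] (hK : ∀ a ∈ K,
    Algebra.TensorProduct.map (AlgHom.id k A) (Ideal.Quotient.mkₐ k K) (conjHom k A a) = 0) :
    IsMonHom.Normal (CommAlgCat.ofHom (Bialgebra.Quotient.mkBialgHom (R := k) K).toAlgHom).op := by
  have : Epi (CommAlgCat.ofHom (Bialgebra.Quotient.mkBialgHom (R := k) K).toAlgHom) := by
    constructor
    intro Z f g hfg
    ext a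
    obtain ⟨a, rfl⟩ := Ideal.Quotient.mk_surjective a
    exact congr($hfg a)
  refine ⟨inferInstance, inferInstance, (CommAlgCat.ofHom (Ideal.Quotient.liftₐ K
    ((Algebra.TensorProduct.map (AlgHom.id k A) (Ideal.Quotient.mkₐ k K)).comp (conjHom k A))
    hK)).op, ?_⟩
  apply Quiver.Hom.unop_inj
  ext a
  have h1 : (conj (op (CommAlgCat.of k A))).unop.hom = conjHom k A := by
    rw [conj, CommAlgCat.unop_hom_mul, CommAlgCat.unop_hom_mul, CommAlgCat.unop_hom_inv]
    rfl
  exact congr(Algebra.TensorProduct.map (AlgHom.id k A)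
    (Ideal.Quotient.mkₐ k K) ($h1 a)).symm

/-- A Hopf ideal stable under the conjugation coaction defines a closed normal subgroup scheme. -/
theorem isClosedImmersion_and_normal_hopfSpec_map [K.IsHopfIdeal k] (hK : ∀ a ∈ K,
    Algebra.TensorProduct.map (AlgHom.id k A) (Ideal.Quotient.mkₐ k K) (conjHom k A a) = 0) :
    let i := (hopfSpec (.of k)).map
      (CommHopfAlgCat.ofHom (Bialgebra.Quotient.mkBialgHom (R := k) K)).op
    IsClosedImmersion i.hom.hom.left ∧ IsMonHom.Normal i.hom.hom := by
  intro i
  have h1 : IsClosedImmersion i.hom.hom.left :=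
    IsClosedImmersion.spec_of_surjective (CommRingCat.ofHom (Ideal.Quotient.mk K))
      Ideal.Quotient.mk_surjective
  refine ⟨h1, ?_⟩
  have := normal_op_ofHom_mkₐ K hK
  -- a closed immersion is a monomorphism, and `Over.forget` reflects monomorphisms
  have : Mono i.hom.hom := by
    have : Mono ((Over.forget _).map i.hom.hom) := inferInstanceAs (Mono i.hom.hom.left)
    exact (Over.forget _).mono_of_mono_map this
  let : (algSpec (.of k)).Monoidal := (braidedAlgSpec (R := .of k)).toMonoidal
  exact @CategoryTheory.IsMonHom.Normal.map _ _ _ _ _ _ (algSpec (.of k)) this _ _ _ _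
    (CommAlgCat.ofHom (Bialgebra.Quotient.mkBialgHom (R := k) K).toAlgHom).op _ ‹Mono i.hom.hom›

/-- The Hopf-algebraic form of simplicity of the group scheme `Spec A`: the augmentation ideal is
nonzero, and every Hopf ideal stable under the conjugation coaction is zero or the augmentation
ideal. -/
structure IsSimpleHopf (k A : Type u) [Field k] [CommRing A] [HopfAlgebra k A] : Prop where
  ker_counit_ne_bot : RingHom.ker (Bialgebra.counitAlgHom k A) ≠ ⊥
  eq_bot_or_eq_ker (K : Ideal A) [K.IsHopfIdeal k] (hK : ∀ a ∈ K,
    Algebra.TensorProduct.map (AlgHom.id k A) (Ideal.Quotient.mkₐ k K) (conjHom k A a) = 0) :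
    K = ⊥ ∨ K = RingHom.ker (Bialgebra.counitAlgHom k A)

theorem IsSimpleGroupScheme.of_iso {G G' : Grp (Over (Spec (.of k)))} (e : G ≅ G')
    (hG : IsSimpleGroupScheme G) : IsSimpleGroupScheme G' where
  nontrivial h := hG.nontrivial <| by
    have := Over.w ((Grp.forget _).mapIso e).hom
    change _ = G.X.hom at this
    rw [← this]
    have : IsIso (Over.Hom.left ((Grp.forget (Over (Spec (CommRingCat.of k)))).mapIso e).hom) :=
      inferInstanceAs (IsIso ((Over.forget _).map ((Grp.forget _).mapIso e).hom))
    exact IsIso.comp_isIso' this h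
  eq_bot_or_eq_top N i hi hN := by
    have hE : IsIso e.inv.hom.hom := inferInstanceAs (IsIso ((Grp.forget _).mapIso e).inv)
    have hl : IsIso e.inv.hom.hom.left :=
      inferInstanceAs (IsIso ((Over.forget _).map e.inv.hom.hom))
    refine (hG.eq_bot_or_eq_top N (i ≫ e.inv) ?_ ?_).imp_right fun h ↦ ?_
    · exact inferInstanceAs (IsClosedImmersion (i.hom.hom.left ≫ e.inv.hom.hom.left))
    · have : Mono (i ≫ e.inv).hom.hom := inferInstanceAs (Mono (i.hom.hom ≫ e.inv.hom.hom))
      rw [IsMonHom.normal_iff_normal_monoidHom] at hN ⊢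
      intro X
      have h := (hN X).map (IsMonHom.monoidHom e.inv.hom.hom X)
        (fun y ↦ ⟨y ≫ e.hom.hom.hom, by
          have : e.hom.hom.hom ≫ e.inv.hom.hom = 𝟙 _ := congr($(e.hom_inv_id).hom.hom)
          simp [this]⟩)
      convert h
      rw [MonoidHom.map_range]
      congr 1
    · exact (isIso_comp_right_iff i e.inv).mp h

theorem isSimpleHopf_of_isSimpleGroupScheme
    (hA : IsSimpleGroupScheme ((hopfSpec (.of k)).obj (op (.of k A)))) : IsSimpleHopf k A where
  ker_counit_ne_bot h := hA.nontrivial <| by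
    have h1 : Function.Bijective (algebraMap k A) := by
      have : Nontrivial A := (Bialgebra.counitAlgHom k A).toRingHom.domain_nontrivial
      refine ⟨(algebraMap k A).injective, fun a ↦ ⟨Coalgebra.counit (R := k) a, ?_⟩⟩
      have := (RingHom.injective_iff_ker_eq_bot (Bialgebra.counitAlgHom k A)).mpr h
      exact this (by simp)
    have : IsIso (CommRingCat.ofHom (algebraMap k A)) :=
      (ConcreteCategory.isIso_iff_bijective _).mpr h1
    exact inferInstanceAs (IsIso (Spec.map (CommRingCat.ofHom (algebraMap k A))))
  eq_bot_or_eq_ker K _ hK := by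
    obtain ⟨h1, h2⟩ := isClosedImmersion_and_normal_hopfSpec_map K hK
    obtain h | h := hA.eq_bot_or_eq_top _ _ h1 h2
    · right
      have : IsIso (Spec.map (CommRingCat.ofHom (algebraMap k (A ⧸ K)))) := h
      have h3 := (isIso_SpecMap_iff.mp this).2
      refine le_antisymm (fun a ha ↦ Submodule.IsCoideal.counit_eq_zero (R := k)
        (I := K.restrictScalars k) ha) fun a ha ↦ ?_
      obtain ⟨c, hc⟩ := h3 (Ideal.Quotient.mk K a)
      have hc' : algebraMap k (A ⧸ K) c = Ideal.Quotient.mk K a := hc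
      have h4 := congr(Coalgebra.counit (R := k) $hc')
      rw [Bialgebra.counit_algebraMap, Bialgebra.Quotient.counit_mk] at h4
      have h5 : Coalgebra.counit (R := k) a = 0 := ha
      rw [← Ideal.Quotient.eq_zero_iff_mem, ← hc', h4, h5, map_zero]
    · left
      have : IsIso ((hopfSpec (.of k)).map
        (CommHopfAlgCat.ofHom (Bialgebra.Quotient.mkBialgHom (R := k) K)).op).hom.hom.left :=
        inferInstanceAs (IsIso ((Grp.forget (Over (Spec (CommRingCat.of k))) ⋙ Over.forget _).map
          ((hopfSpec (.of k)).map
            (CommHopfAlgCat.ofHom (Bialgebra.Quotient.mkBialgHom (R := k) K)).op)))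
      have : IsIso (Spec.map (CommRingCat.ofHom (Ideal.Quotient.mk K))) := this
      have h3 := (isIso_SpecMap_iff.mp this).1
      rw [eq_bot_iff]
      intro a ha
      exact h3 ((Ideal.Quotient.eq_zero_iff_mem.mpr ha).trans (map_zero _).symm)

theorem exists_iso_hopfSpec_of_isFinite (G : Grp (Over (Spec (.of k)))) [hG : IsFinite G.X.hom] :
    ∃ (A : Type u) (_ : CommRing A) (_ : HopfAlgebra k A), Module.Finite k A ∧
      Nonempty ((hopfSpec (.of k)).obj (op (.of k A)) ≅ G) := by
  have : IsAffine G.X.left := isAffine_of_isAffineHom G.X.hom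
  obtain ⟨B, ⟨e⟩⟩ := essImage_hopfSpec.mpr this
  refine ⟨B.unop, inferInstance, B.unop.hopfAlgebra, ?_, ⟨e⟩⟩
  have := Over.w ((Grp.forget _).mapIso e).hom
  change _ ≫ G.X.hom = Spec.map (CommRingCat.ofHom (algebraMap k B.unop)) at this
  have h1 : IsIso (Over.Hom.left ((Grp.forget (Over (Spec (CommRingCat.of k)))).mapIso e).hom) :=
      inferInstanceAs (IsIso ((Over.forget _).map ((Grp.forget _).mapIso e).hom))
  have h2 : IsFinite (Spec.map (CommRingCat.ofHom (algebraMap k B.unop))) := by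
    rw [← this]
    have : IsFinite (Over.Hom.left ((Grp.forget (Over (Spec (CommRingCat.of k)))).mapIso e).hom) :=
      inferInstance
    exact MorphismProperty.comp_mem _ _ _ this hG
  rw [IsFinite.SpecMap_iff] at h2
  exact RingHom.finite_algebraMap.mp h2

end NormalHopfIdeals

open Opposite WithConv

/-! ### The kernel of the Frobenius morphism -/

section FrobeniusKernel

variable {k A : Type u} [Field k] [CommRing A] [HopfAlgebra k A]

theorem comp_conjHom {R : Type*} [CommRing R] [Algebra k R] (g : A ⊗[k] A →ₐ[k] R) :
    toConv (g.comp (conjHom k A)) = toConv (g.comp Algebra.TensorProduct.includeLeft) *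
      toConv (g.comp Algebra.TensorProduct.includeRight) *
      toConv ((g.comp Algebra.TensorProduct.includeLeft).comp
        (HopfAlgebra.antipodeAlgHom k A)) := by
  rw [conjHom, AlgHom.comp_convMul_distrib, AlgHom.comp_convMul_distrib]
  rfl

theorem conv_mul_comp_antipode {R : Type*} [CommRing R] [Algebra k R] (f : A →ₐ[k] R) :
    toConv f * toConv (f.comp (HopfAlgebra.antipodeAlgHom k A)) = 1 := by
  have h1 : (toConv (AlgHom.id k A)) * toConv (HopfAlgebra.antipodeAlgHom k A) = 1 :=
    mul_inv_cancel (toConv (AlgHom.id k A))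
  have h2 := AlgHom.comp_convMul_distrib f (toConv (AlgHom.id k A))
    (toConv (HopfAlgebra.antipodeAlgHom k A))
  rw [h1] at h2
  refine WithConv.ofConv_injective (h2.symm.trans ?_)
  ext a
  simp [AlgHom.convOne_def]

/-- Conjugating the neutral element gives the neutral element: a point of `Spec A × Spec A` whose
second component is trivial is sent by conjugation to the trivial point. -/
theorem apply_conjHom_of_trivial_right {R : Type*} [CommRing R] [Algebra k R] (g : A ⊗[k] A →ₐ[k] R)
    (hg : ∀ a, g (1 ⊗ₜ a) = algebraMap k R (Coalgebra.counit a)) (a : A) :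
    g (conjHom k A a) = algebraMap k R (Coalgebra.counit a) := by
  have h1 := comp_conjHom g
  have h2 : toConv (g.comp Algebra.TensorProduct.includeRight) = 1 :=
    WithConv.ofConv_injective (AlgHom.ext fun a ↦ hg a)
  rw [h2, mul_one, conv_mul_comp_antipode] at h1
  exact congr(($h1).ofConv a)

/-- The ideal of the kernel of the Frobenius morphism: it is generated by the `p`-th powers of the
elements of the augmentation ideal. -/
def frobeniusIdeal (k A : Type u) [Field k] [CommRing A] [HopfAlgebra k A] (p : ℕ) : Ideal A :=
  Ideal.span ((· ^ p) '' (RingHom.ker (Bialgebra.counitAlgHom k A) : Set A))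

theorem pow_mem_frobeniusIdeal (p : ℕ) {a : A} (ha : Coalgebra.counit (R := k) a = 0) :
    a ^ p ∈ frobeniusIdeal k A p :=
  Ideal.subset_span ⟨a, ha, rfl⟩

theorem frobeniusIdeal_le_ker (p : ℕ) {B : Type*} [CommRing B] [Algebra k B] (f : A →ₐ[k] B)
    (h : ∀ a : A, Coalgebra.counit (R := k) a = 0 → f a ^ p = 0) :
    frobeniusIdeal k A p ≤ RingHom.ker f := by
  refine Ideal.span_le.mpr ?_
  rintro _ ⟨a, ha, rfl⟩
  simpa using h a ha

variable (p : ℕ) [Fact p.Prime] [CharP k p]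

theorem Algebra.add_pow_char (k : Type*) [Field k] (p : ℕ) [Fact p.Prime] [CharP k p]
    {R : Type*} [CommRing R] [Algebra k R] (x y : R) :
    (x + y) ^ p = x ^ p + y ^ p := by
  rcases subsingleton_or_nontrivial R
  · exact Subsingleton.elim _ _
  have : CharP R p := charP_of_injective_algebraMap (algebraMap k R).injective p
  exact _root_.add_pow_char x y p

/-- In characteristic `p`, two algebra homomorphisms out of a tensor product whose `p`-th powers
agree on pure tensors have equal `p`-th powers. -/
theorem AlgHom.pow_eq_pow_of_tmul {B C R : Type*} [CommRing B] [CommRing C] [CommRing R]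
    [Algebra k B] [Algebra k C] [Algebra k R] (f g : B ⊗[k] C →ₐ[k] R)
    (h : ∀ x y, f (x ⊗ₜ y) ^ p = g (x ⊗ₜ y) ^ p) (t : B ⊗[k] C) : f t ^ p = g t ^ p := by
  induction t with
  | zero => simp
  | tmul x y => exact h x y
  | add s t hs ht =>
    rw [map_add, map_add, Algebra.add_pow_char k, Algebra.add_pow_char k, hs, ht]

/-- Modulo the Frobenius ideal, `a ^ p` depends only on the value of `a` at the neutral element. -/
theorem mk_pow_eq (a : A) : Ideal.Quotient.mk (frobeniusIdeal k A p) a ^ p =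
    algebraMap k _ (Coalgebra.counit (R := k) a) ^ p := by
  have h := pow_mem_frobeniusIdeal (k := k) p
    (a := a - algebraMap k A (Coalgebra.counit (R := k) a))
    (by simp)
  have h' : Ideal.Quotient.mk (frobeniusIdeal k A p) (algebraMap k A (Coalgebra.counit a)) =
      algebraMap k _ (Coalgebra.counit (R := k) a) := rfl
  rw [← Ideal.Quotient.eq_zero_iff_mem, map_pow, map_sub, h'] at h
  rw [← sub_add_cancel (Ideal.Quotient.mk (frobeniusIdeal k A p) a)
    (algebraMap k _ (Coalgebra.counit (R := k) a)), Algebra.add_pow_char k, h,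
    zero_add]

theorem lift_counit_comul (a : A) : Algebra.TensorProduct.lift (Bialgebra.counitAlgHom k A)
    (Bialgebra.counitAlgHom k A) (fun _ _ ↦ .all ..) (Coalgebra.comul a) =
      Coalgebra.counit (R := k) a := by
  have h := AlgHom.convMul_apply (1 : WithConv (A →ₐ[k] k)) 1 a
  rw [one_mul] at h
  exact h.symm

theorem map_mk_comul_pow_eq_zero {a : A} (ha : Coalgebra.counit (R := k) a = 0) :
    Algebra.TensorProduct.map (Ideal.Quotient.mkₐ k (frobeniusIdeal k A p))
      (Ideal.Quotient.mkₐ k (frobeniusIdeal k A p)) (Coalgebra.comul a) ^ p = 0 := by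
  have hp : p ≠ 0 := (Fact.out : p.Prime).ne_zero
  rw [AlgHom.pow_eq_pow_of_tmul (k := k) p _
    ((Algebra.ofId k _).comp (Algebra.TensorProduct.lift (Bialgebra.counitAlgHom k A)
      (Bialgebra.counitAlgHom k A) (fun _ _ ↦ .all ..)))]
  · rw [AlgHom.comp_apply, lift_counit_comul, ha, map_zero, zero_pow hp]
  · intro x y
    simp only [Algebra.TensorProduct.map_tmul, Ideal.Quotient.mkₐ_eq_mk, AlgHom.comp_apply,
      Algebra.TensorProduct.tmul_pow, Algebra.TensorProduct.lift_tmul, mk_pow_eq,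
      Bialgebra.counitAlgHom_apply, Algebra.ofId_apply]
    simp only [Algebra.algebraMap_eq_smul_one, smul_pow, one_pow, mul_pow,
      TensorProduct.smul_tmul_smul]
    rw [Algebra.TensorProduct.one_def]

instance isHopfIdeal_frobeniusIdeal : (frobeniusIdeal k A p).IsHopfIdeal k where
  counit_eq_zero := by
    have hp : p ≠ 0 := (Fact.out : p.Prime).ne_zero
    exact frobeniusIdeal_le_ker p (Bialgebra.counitAlgHom k A) fun a ha ↦ by simp [ha, hp]
  map_mkQ_comul_eq_zero := by
    set K := frobeniusIdeal k A p
    exact frobeniusIdeal_le_ker p ((Algebra.TensorProduct.map (Ideal.Quotient.mkₐ k K)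
      (Ideal.Quotient.mkₐ k K)).comp (Bialgebra.comulAlgHom k A)) fun a ha ↦
        map_mk_comul_pow_eq_zero p ha
  antipode_mem a ha := by
    set K := frobeniusIdeal k A p
    have h := frobeniusIdeal_le_ker p ((Ideal.Quotient.mkₐ k K).comp
      (HopfAlgebra.antipodeAlgHom k A)) (fun a ha ↦ by
        have h1 := pow_mem_frobeniusIdeal (k := k) p (a := HopfAlgebra.antipode k a)
          (by simpa using ha)
        simpa [← map_pow, Ideal.Quotient.eq_zero_iff_mem] using h1) ha
    simpa [RingHom.mem_ker, Ideal.Quotient.eq_zero_iff_mem] using h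

/-- The kernel of the Frobenius morphism is normal: the Frobenius of the conjugate of `h` is the
conjugate of the Frobenius of `h`, and so is trivial if the Frobenius of `h` is. -/
theorem frobeniusIdeal_normal (a : A) (ha : a ∈ frobeniusIdeal k A p) :
    Algebra.TensorProduct.map (AlgHom.id k A) (Ideal.Quotient.mkₐ k (frobeniusIdeal k A p))
      (conjHom k A a) = 0 := by
  have hp : p ≠ 0 := (Fact.out : p.Prime).ne_zero
  set K := frobeniusIdeal k A p
  refine frobeniusIdeal_le_ker p ((Algebra.TensorProduct.map (AlgHom.id k A)
    (Ideal.Quotient.mkₐ k K)).comp (conjHom k A)) (fun a ha ↦ ?_) ha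
  -- `g` is the variant of `id ⊗ mk` that replaces the second component by the neutral element;
  -- the `p`-th powers of the two homomorphisms agree
  set g : A ⊗[k] A →ₐ[k] A ⊗[k] (A ⧸ K) := Algebra.TensorProduct.map (AlgHom.id k A)
    ((Algebra.ofId k (A ⧸ K)).comp (Bialgebra.counitAlgHom k A)) with hg
  have h3 : g (conjHom k A a) = 0 := by
    rw [apply_conjHom_of_trivial_right, ha, map_zero]
    intro a
    simp [hg, Algebra.ofId_apply, Algebra.algebraMap_eq_smul_one, Algebra.TensorProduct.one_def]
  rw [AlgHom.comp_apply, AlgHom.pow_eq_pow_of_tmul (k := k) p _ g, h3, zero_pow hp]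
  intro x y
  simp [hg, Algebra.TensorProduct.tmul_pow, K, mk_pow_eq, Algebra.ofId_apply]

end FrobeniusKernel

/-! ### Subalgebras of the dual and normal Hopf ideals -/

section Annihilator

open Coalgebra HopfAlgebra

theorem TensorProduct.eq_zero_of_forall_dual {k V W : Type*} [Field k] [AddCommGroup V] [Module k V]
    [AddCommGroup W] [Module k W] [Module.Finite k V] [Module.Finite k W] {t : V ⊗[k] W}
    (h : ∀ (φ : Module.Dual k V) (ψ : Module.Dual k W),
      LinearMap.mul' k k (TensorProduct.map φ ψ t) = 0) : t = 0 := by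
  rw [← Module.forall_dual_apply_eq_zero_iff k]
  intro f
  obtain ⟨s, rfl⟩ := (TensorProduct.dualDistribEquiv k V W).surjective f
  induction s with
  | zero => simp
  | add x y hx hy => simp only [map_add, LinearMap.add_apply, hx, hy, add_zero]
  | tmul φ ψ =>
    rw [← h φ ψ]
    clear h
    induction t with
    | zero => simp
    | add x y hx hy => simp only [map_add, hx, hy]
    | tmul v w => simp [TensorProduct.dualDistribEquiv, TensorProduct.dualDistribEquivOfBasis]

variable {k A : Type u} [Field k] [CommRing A] [HopfAlgebra k A]

/-- In Sweedler notation, `conjHom k A a = ∑ a₍₁₎ * S a₍₃₎ ⊗ a₍₂₎`. -/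
theorem conjHom_eq_sum {ι κ : Type*} {a : A} (r : Coalgebra.Repr k a ι)
    (s : ∀ i, Coalgebra.Repr k (r.left i) κ) :
    conjHom k A a = ∑ i ∈ r.index, ∑ j ∈ (s i).index,
      ((s i).left j * antipode k (r.right i)) ⊗ₜ (s i).right j := by
  have h (b : A) : (toConv Algebra.TensorProduct.includeLeft *
      toConv Algebra.TensorProduct.includeRight : WithConv (A →ₐ[k] A ⊗[k] A)) b =
      comul b := by
    rw [AlgHom.convMul_apply]
    conv_rhs => rw [← (ℛ k b).eq]
    conv_lhs => rw [← (ℛ k b).eq]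
    simp
  change (_ * _ : WithConv (A →ₐ[k] A ⊗[k] A)) a = _
  rw [AlgHom.convMul_apply, ← r.eq]
  simp only [map_sum, Algebra.TensorProduct.lift_tmul]
  refine Finset.sum_congr rfl fun i _ ↦ ?_
  change (_ * _ : WithConv (A →ₐ[k] A ⊗[k] A)) (r.left i) * _ = _
  rw [h, ← (s i).eq, Finset.sum_mul]
  simp

variable [Module.Finite k A]

/-- The linear map `f ⊗ g ↦ f * b * S g`. -/
def HopfDual.sandwich (b : HopfDual k A) : HopfDual k A ⊗[k] HopfDual k A →ₗ[k] HopfDual k A :=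
  LinearMap.mul' k _ ∘ₗ TensorProduct.map (LinearMap.mulRight k b) (antipode k)

@[simp]
theorem HopfDual.sandwich_tmul (b f g : HopfDual k A) :
    HopfDual.sandwich b (f ⊗ₜ g) = f * b * antipode k g := rfl

/-- The adjoint action `f ↦ (b ↦ ∑ f₍₁₎ * b * S f₍₂₎)` of the dual Hopf algebra on itself. -/
def HopfDual.adj (f b : HopfDual k A) : HopfDual k A := HopfDual.sandwich b (comul f)

/-- The adjoint action on the dual is the transpose of the conjugation coaction. -/
theorem HopfDual.adj_apply (f b : HopfDual k A) (a : A) :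
    HopfDual.adj f b a = HopfDual.tensorEquiv k A (f ⊗ₜ b) (conjHom k A a) := by
  have h (t : HopfDual k A ⊗[k] HopfDual k A) : HopfDual.sandwich b t a =
      ∑ i ∈ (ℛ k a).index, ∑ j ∈ (ℛ k ((ℛ k a).left i)).index,
        HopfDual.tensorEquiv k A t ((ℛ k ((ℛ k a).left i)).left j ⊗ₜ antipode k ((ℛ k a).right i)) *
          b ((ℛ k ((ℛ k a).left i)).right j) := by
    induction t with
    | zero => simp
    | add x y hx hy => simp only [map_add, LinearMap.add_apply, hx, hy, add_mul,
        Finset.sum_add_distrib]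
    | tmul f g =>
      rw [HopfDual.sandwich_tmul, HopfDual.mul_repr _ _ (ℛ k a)]
      refine Finset.sum_congr rfl fun i _ ↦ ?_
      rw [HopfDual.mul_repr _ _ (ℛ k ((ℛ k a).left i)), Finset.sum_mul]
      refine Finset.sum_congr rfl fun j _ ↦ ?_
      rw [HopfDual.tensorEquiv_tmul, mul_right_comm]
      rfl
  rw [HopfDual.adj, h, conjHom_eq_sum (ℛ k a) fun i ↦ ℛ k ((ℛ k a).left i)]
  simp only [map_sum, HopfDual.tensorEquiv_tmul, HopfDual.comul_def, HopfDual.tensorEquiv_comulMap]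

theorem HopfDual.adj_mul (f g b : HopfDual k A) : adj (f * g) b = adj f (adj g b) := by
  have h1 (f g : HopfDual k A) (t : HopfDual k A ⊗[k] HopfDual k A) :
      sandwich b ((f ⊗ₜ g) * t) = f * sandwich b t * antipode k g := by
    induction t with
    | zero => simp
    | add x y hx hy => simp only [mul_add, map_add, hx, hy, add_mul]
    | tmul f' g' => simp [antipode_mul_antidistrib, mul_assoc]
  have h2 (s t : HopfDual k A ⊗[k] HopfDual k A) :
      sandwich b (s * t) = sandwich (sandwich b t) s := by
    induction s with
    | zero => simp
    | add x y hx hy => simp only [add_mul, map_add, hx, hy]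
    | tmul f g => rw [h1, sandwich_tmul]
  rw [adj, Bialgebra.comul_mul, h2]
  rfl

/-- An element of `B ⊗ B` pairs to zero with `x ⊗ a` if all of `B` vanishes on `a`. -/
theorem HopfDual.tensorEquiv_eq_zero_of_mem_range {B : Subalgebra k (HopfDual k A)}
    {t : HopfDual k A ⊗[k] HopfDual k A} (ht : t ∈ (Algebra.TensorProduct.map B.val B.val).range)
    {a : A} (ha : ∀ b ∈ B, b a = 0) (x : A) : tensorEquiv k A t (x ⊗ₜ a) = 0 := by
  obtain ⟨t, rfl⟩ := ht
  induction t with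
  | zero => simp
  | add y z hy hz =>
    simp only [RingHom.coe_coe, AlgHom.toRingHom_eq_coe, map_add, LinearMap.add_apply] at hy hz ⊢
    rw [hy, hz, add_zero]
  | tmul f g => simp [ha g g.2]

/-- The ideal of the elements on which a subbialgebra of the dual vanishes. -/
def HopfDual.annihilator (B : Subalgebra k (HopfDual k A))
    (hB : ∀ b ∈ B, comul (R := k) b ∈ (Algebra.TensorProduct.map B.val B.val).range) : Ideal A where
  carrier := {a | ∀ b ∈ B, b a = 0}
  add_mem' ha ha' b hb := by rw [map_add, ha b hb, ha' b hb, add_zero]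
  zero_mem' b _ := map_zero _
  smul_mem' x a ha b hb := by
    rw [smul_eq_mul, ← tensorEquiv_comulMap]
    exact tensorEquiv_eq_zero_of_mem_range (hB b hb) ha x

section

variable {B : Subalgebra k (HopfDual k A)}
  (hB : ∀ b ∈ B, comul (R := k) b ∈ (Algebra.TensorProduct.map B.val B.val).range)

/-- Double annihilator: an element of the dual that vanishes on the annihilator of `B` lies in
`B`. -/
theorem HopfDual.mem_of_forall_mem_annihilator {f : HopfDual k A}
    (hf : ∀ a ∈ annihilator B hB, f a = 0) : f ∈ B := by
  have h := Subspace.dualCoannihilator_dualAnnihilator_eq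
    (W := (Subalgebra.toSubmodule B).map (equivDual k A).toLinearMap)
  have h1 : equivDual k A f ∈ (Subalgebra.toSubmodule B).map (equivDual k A).toLinearMap := by
    rw [← h, Submodule.mem_dualAnnihilator]
    intro a ha
    refine hf a fun b hb ↦ ?_
    rw [Submodule.mem_dualCoannihilator] at ha
    exact ha _ ⟨b, hb, rfl⟩
  obtain ⟨b, hb, h2⟩ := h1
  rwa [← (equivDual k A).injective h2]

/-- The linear forms on the quotient by the annihilator of `B` are elements of `B`. -/
theorem HopfDual.comp_mk_mem (φ : Module.Dual k (A ⧸ annihilator B hB)) :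
    (equivDual k A).symm (φ ∘ₗ (Ideal.Quotient.mkₐ k (annihilator B hB)).toLinearMap) ∈ B := by
  refine mem_of_forall_mem_annihilator hB fun a ha ↦ ?_
  change φ (Ideal.Quotient.mk _ a) = 0
  rw [Ideal.Quotient.eq_zero_iff_mem.mpr ha, map_zero]

theorem HopfDual.isHopfIdeal_annihilator (hS : ∀ b ∈ B, antipode k b ∈ B) :
    (annihilator B hB).IsHopfIdeal k where
  counit_eq_zero a ha := ha 1 B.one_mem
  map_mkQ_comul_eq_zero a ha := by
    refine TensorProduct.eq_zero_of_forall_dual fun φ ψ ↦ ?_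
    rw [← LinearMap.comp_apply (TensorProduct.map φ ψ), ← TensorProduct.map_comp]
    exact ha _ (B.mul_mem (comp_mk_mem hB φ) (comp_mk_mem hB ψ))
  antipode_mem a ha b hb := ha _ (hS b hb)

theorem HopfDual.annihilator_normal (hadj : ∀ f, ∀ b ∈ B, adj f b ∈ B) (a : A)
    (ha : a ∈ annihilator B hB) : Algebra.TensorProduct.map (AlgHom.id k A)
      (Ideal.Quotient.mkₐ k (annihilator B hB)) (conjHom k A a) = 0 := by
  refine TensorProduct.eq_zero_of_forall_dual fun φ ψ ↦ ?_
  have h := ha _ (hadj ((equivDual k A).symm φ) _ (comp_mk_mem hB ψ))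
  rw [adj_apply] at h
  rw [← h]
  generalize conjHom k A a = t
  induction t with
  | zero => simp
  | add x y hx hy => simp only [map_add, hx, hy]
  | tmul x y =>
    rw [HopfDual.tensorEquiv_tmul]
    rfl

/-- Normal subgroup schemes seen in the dual: the annihilator of a subalgebra stable under
comultiplication, antipode and adjoint action is a normal Hopf ideal. -/
theorem IsSimpleHopf.subalgebra_eq_bot_or_eq_top (hA : IsSimpleHopf k A)
    (hB : ∀ b ∈ B, comul (R := k) b ∈ (Algebra.TensorProduct.map B.val B.val).range)
    (hS : ∀ b ∈ B, antipode k b ∈ B) (hadj : ∀ f, ∀ b ∈ B, HopfDual.adj f b ∈ B) :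
    B = ⊥ ∨ B = ⊤ := by
  have := HopfDual.isHopfIdeal_annihilator hB hS
  refine (hA.eq_bot_or_eq_ker _ (HopfDual.annihilator_normal hB hadj)).symm.imp
    (fun h ↦ ?_) fun h ↦ ?_
  · rw [eq_bot_iff]
    intro b hb
    refine ⟨b 1, HopfDual.ext fun a ↦ ?_⟩
    have h1 : a - algebraMap k A (counit a) ∈ HopfDual.annihilator B hB := by
      rw [h, RingHom.mem_ker]
      simp
    have h2 := h1 b hb
    rw [map_sub, Algebra.algebraMap_eq_smul_one, map_smul, sub_eq_zero] at h2
    rw [h2, smul_eq_mul, mul_comm]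
    rfl
  · rw [eq_top_iff]
    intro b _
    refine HopfDual.mem_of_forall_mem_annihilator hB fun a ha ↦ ?_
    rw [h] at ha
    rw [(Submodule.mem_bot A).mp ha, map_zero]

end

/-- The version of `IsSimpleHopf.subalgebra_eq_bot_or_eq_top` for a subalgebra given by generators;
the stability conditions need only be checked on generators, of the subalgebra and of the dual. -/
theorem IsSimpleHopf.adjoin_eq_bot_or_eq_top (hA : IsSimpleHopf k A) {S T : Set (HopfDual k A)}
    (hcomul : ∀ s ∈ S, comul (R := k) s ∈
      (Algebra.TensorProduct.map (Algebra.adjoin k S).val (Algebra.adjoin k S).val).range)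
    (hS : ∀ s ∈ S, antipode k s ∈ Algebra.adjoin k S) (hT : Algebra.adjoin k T = ⊤)
    (hadj : ∀ t ∈ T, ∀ b ∈ Algebra.adjoin k S, HopfDual.adj t b ∈ Algebra.adjoin k S) :
    Algebra.adjoin k S = ⊥ ∨ Algebra.adjoin k S = ⊤ := by
  refine hA.subalgebra_eq_bot_or_eq_top (fun b hb ↦ ?_) (fun b hb ↦ ?_) (fun f b hb ↦ ?_)
  · have h : Algebra.adjoin k S ≤ (Algebra.TensorProduct.map (Algebra.adjoin k S).val
      (Algebra.adjoin k S).val).range.comap (Bialgebra.comulAlgHom k (HopfDual k A)) :=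
      Algebra.adjoin_le hcomul
    exact h hb
  · induction hb using Algebra.adjoin_induction with
    | mem x hx => exact hS x hx
    | algebraMap c =>
      rw [Algebra.algebraMap_eq_smul_one, map_smul, antipode_one]
      exact Subalgebra.smul_mem _ (one_mem _) c
    | add x y _ _ hx hy => rw [map_add]; exact add_mem hx hy
    | mul x y _ _ hx hy => rw [antipode_mul_antidistrib]; exact mul_mem hy hx
  · have hf : f ∈ Algebra.adjoin k T := hT ▸ Algebra.mem_top
    induction hf using Algebra.adjoin_induction generalizing b with
    | mem x hx => exact hadj x hx b hb
    | algebraMap c =>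
      rw [HopfDual.adj, Algebra.algebraMap_eq_smul_one, map_smul, Bialgebra.comul_one,
        Algebra.TensorProduct.one_def, map_smul, HopfDual.sandwich_tmul, antipode_one, one_mul,
        mul_one]
      exact Subalgebra.smul_mem _ hb c
    | add x y _ _ hx hy =>
      rw [HopfDual.adj, map_add, map_add]
      exact add_mem (hx b hb) (hy b hb)
    | mul x y _ _ hx hy =>
      rw [HopfDual.adj_mul]
      exact hx _ (hy b hb)

end Annihilator

/-! ### Duality -/

section Duality

open Coalgebra HopfAlgebra

variable {k A : Type u} [Field k] [CommRing A] [HopfAlgebra k A] [Module.Finite k A]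

instance HopfDual.instModuleFinite {k H : Type*} [Field k] [Ring H] [HopfAlgebra k H]
    [Module.Finite k H] :
    Module.Finite k (HopfDual k H) :=
  Module.Finite.equiv (equivDual k H).symm

theorem HopfDual.finrank_eq {k H : Type*} [Field k] [Ring H] [HopfAlgebra k H] [Module.Finite k H] :
    Module.finrank k (HopfDual k H) = Module.finrank k H :=
  (equivDual k H).finrank_eq.trans Subspace.dual_finrank_eq

/-- The elements of the dual separate the elements of `A`. -/
theorem HopfDual.eq_of_forall_apply_eq {a b : A} (h : ∀ f : HopfDual k A, f a = f b) : a = b := by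
  rw [← sub_eq_zero, ← Module.forall_dual_apply_eq_zero_iff k]
  intro f
  rw [map_sub, sub_eq_zero]
  exact h ((equivDual k A).symm f)

variable {H : Type u} [Ring H] [HopfAlgebra k H] [IsCocomm k H]

/-- The transpose `A → H*` of a bialgebra homomorphism `H → A*`. -/
def HopfDual.transpose [Module.Finite k H] (Ψ : H →ₐc[k] HopfDual k A) : A →ₐc[k] HopfDual k H := by
  let φ : A →ₗ[k] HopfDual k H := (equivDual k H).symm.toLinearMap ∘ₗ
    ((equivDual k A).toLinearMap ∘ₗ (Ψ : H →ₗ[k] HopfDual k A)).flip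
  have hφ (a : A) (h : H) : φ a h = Ψ h a := rfl
  refine .ofAlgHom (.ofLinearMap φ ?_ ?_) ?_ ?_
  · ext h
    rw [hφ, one_apply, ← counit_def, CoalgHomClass.counit_comp_apply]
  · intro a b
    ext h
    rw [hφ, mul_def, ← tensorEquiv_comulMap, ← comul_def, ← CoalgHomClass.map_comp_comul_apply]
    generalize comul (R := k) h = t
    induction t with
    | zero => simp
    | add x y hx hy => simp only [map_add, LinearMap.add_apply, hx, hy]
    | tmul x y => rfl
  · ext a
    change Ψ 1 a = _
    rw [map_one]
    rfl
  · refine AlgHom.ext fun a ↦ tensor_ext fun h h' ↦ ?_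
    change tensorEquiv k H (TensorProduct.map φ φ (comul a)) (h ⊗ₜ h') =
      tensorEquiv k H (comulMap k H (φ a)) (h ⊗ₜ h')
    rw [tensorEquiv_comulMap, hφ, map_mul, mul_def]
    generalize comul (R := k) a = t
    induction t with
    | zero => simp
    | add x y hx hy => simp only [map_add, LinearMap.add_apply, hx, hy]
    | tmul x y => rfl

theorem HopfDual.transpose_bijective [Module.Finite k H] {Ψ : H →ₐc[k] HopfDual k A}
    (hΨ : Function.Bijective Ψ) :
    Function.Bijective (transpose Ψ) := by
  have h1 : Function.Injective (transpose Ψ : A →ₗ[k] HopfDual k H) := fun a b hab ↦ by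
    refine eq_of_forall_apply_eq (k := k) fun f ↦ ?_
    obtain ⟨h, rfl⟩ := hΨ.2 f
    exact congr($hab h)
  refine ⟨h1, (LinearMap.injective_iff_surjective_of_finrank_eq_finrank ?_).mp h1⟩
  rw [finrank_eq, ← (LinearEquiv.ofBijective (Ψ : H →ₗ[k] HopfDual k A) hΨ).finrank_eq.symm,
    finrank_eq]

/-- A bialgebra isomorphism `H ≃ A*` dualizes to an isomorphism between `Spec A` and `Spec H*`. -/
theorem nonempty_iso_of_bijective [Module.Finite k H] {Ψ : H →ₐc[k] HopfDual k A}
    (hΨ : Function.Bijective Ψ) :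
    Nonempty ((hopfSpec (.of k)).obj (op (.of k A)) ≅
      (hopfSpec (.of k)).obj (op (.of k (HopfDual k H)))) :=
  ⟨(hopfSpec (.of k)).mapIso (CommHopfAlgCat.isoMk
    (BialgEquiv.ofBijective _ (HopfDual.transpose_bijective hΨ))).symm.op⟩

end Duality

/-! ### The étale case -/

section Etale

open Coalgebra HopfAlgebra

variable {k A : Type u} [Field k] [CommRing A] [HopfAlgebra k A]

/-- Translating by points, an idempotent supported at the neutral element yields one supported at
any other `k`-point `g`. -/
theorem exists_point_idempotent {e : A} (he : counit (R := k) e = 1)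
    (hae : ∀ a : A, a * e = algebraMap k A (counit a) * e) (g : A →ₐ[k] k) :
    ∃ e' : A, g e' = 1 ∧ ∀ a : A, a * e' = algebraMap k A (g a) * e' := by
  -- `τ g` is the algebra homomorphism dual to translation by `g`
  let τ (g : WithConv (A →ₐ[k] k)) : WithConv (A →ₐ[k] A) :=
    toConv ((Algebra.ofId k A).comp g.ofConv) * toConv (AlgHom.id k A)
  have hcomp {B : Type u} [CommRing B] [Algebra k B] (f : A →ₐ[k] B) (g : WithConv (A →ₐ[k] k)) :
      f.comp (τ g).ofConv = (toConv ((Algebra.ofId k B).comp g.ofConv) * toConv f).ofConv := by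
    rw [AlgHom.comp_convMul_distrib]
    congr 2
    rw [← AlgHom.comp_assoc]
    congr 2
    exact Subsingleton.elim _ _
  have hg (g g' : WithConv (A →ₐ[k] k)) (a : A) : g ((τ g') a) = (g' * g) a := by
    have h1 := hcomp g.ofConv g'
    rw [show Algebra.ofId k k = AlgHom.id k k from Subsingleton.elim _ _, AlgHom.id_comp] at h1
    exact congr($h1 a)
  have hτ (g g' : WithConv (A →ₐ[k] k)) (a : A) : τ g (τ g' a) = τ (g' * g) a := by
    have h1 := hcomp (τ g).ofConv g'
    have h2 := AlgHom.comp_convMul_distrib (Algebra.ofId k A) g' g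
    have h3 : (toConv ((Algebra.ofId k A).comp g'.ofConv) * toConv (τ g).ofConv).ofConv =
        (τ (g' * g)).ofConv := by
      simp only [τ, h2, toConv_ofConv, mul_assoc]
    exact congr($(h1.trans h3) a)
  have hτ1 (a : A) : τ 1 a = a := by
    have h1 : toConv ((Algebra.ofId k A).comp (1 : WithConv (A →ₐ[k] k)).ofConv) = 1 := rfl
    simp only [τ, h1, one_mul]
    rfl
  refine ⟨τ (toConv g)⁻¹ e, ?_, fun a ↦ ?_⟩
  · have h1 := hg (toConv g) (toConv g)⁻¹ e
    rw [inv_mul_cancel] at h1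
    exact h1.trans he
  · have h2 := hae (τ (toConv g) a)
    have h3 := hg 1 (toConv g) a
    rw [mul_one] at h3
    have h4 : counit (R := k) (τ (toConv g) a) = g a := h3
    have h5 := congr((τ (toConv g)⁻¹).ofConv $h2)
    rw [map_mul, map_mul, h4, AlgHom.commutes] at h5
    have h6 := hτ (toConv g)⁻¹ (toConv g) a
    rw [mul_inv_cancel, hτ1] at h6
    have h7 : (τ (toConv g)⁻¹).ofConv (τ (toConv g) a) = a := h6
    rw [h7] at h5
    exact h5

variable [Module.Finite k A]

/-- A `k`-point of `Spec A`, as a group-like element of the dual of `A`. -/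
def HopfDual.ofPoint (g : A →ₐ[k] k) : GroupLike k (HopfDual k A) where
  val := (equivDual k A).symm g.toLinearMap
  isGroupLikeElem_val :=
    { counit_eq_one := map_one g
      comul_eq_tmul_self := tensor_ext fun a b ↦ by
        rw [comul_def, tensorEquiv_comulMap, tensorEquiv_tmul]
        exact map_mul g a b }

/-- If the augmentation ideal is idempotent, the neutral element is an open point: there is an
idempotent that is `1` there and is killed by the augmentation ideal. -/
theorem exists_mul_eq_smul_of_isIdempotentElem
    (hI : IsIdempotentElem (RingHom.ker (Bialgebra.counitAlgHom k A))) :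
    ∃ e : A, counit (R := k) e = 1 ∧ ∀ a : A, a * e = algebraMap k A (counit a) * e := by
  have : IsNoetherianRing A := IsNoetherianRing.of_finite k A
  obtain ⟨e, he, hIe⟩ := (Ideal.isIdempotentElem_iff_of_fg _ (IsNoetherian.noetherian _)).mp hI
  have he0 : counit (R := k) e = 0 := by
    have : e ∈ RingHom.ker (Bialgebra.counitAlgHom k A) := hIe ▸ Ideal.mem_span_singleton_self e
    exact this
  refine ⟨1 - e, by simp [he0], fun a ↦ ?_⟩
  have ha : a - algebraMap k A (counit a) ∈ RingHom.ker (Bialgebra.counitAlgHom k A) := by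
    simp [RingHom.mem_ker]
  rw [hIe] at ha
  obtain ⟨c, hc⟩ := Ideal.mem_span_singleton'.mp ha
  rw [← sub_eq_zero, ← sub_mul, ← hc, mul_assoc, he.mul_one_sub_self, mul_zero]

/-- If the augmentation ideal is idempotent, the `k`-points separate the elements of `A`. For
`a ≠ 0` the annihilator of `a` lies in a maximal ideal, that is, in the kernel of a point `g`, by
the Nullstellensatz; but if `g a = 0` then the idempotent supported at `g` annihilates `a`. -/
theorem eq_zero_of_forall_point [IsAlgClosed k]
    (hI : IsIdempotentElem (RingHom.ker (Bialgebra.counitAlgHom k A))) {a : A}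
    (ha : ∀ g : A →ₐ[k] k, g a = 0) : a = 0 := by
  obtain ⟨e, he, hae⟩ := exists_mul_eq_smul_of_isIdempotentElem hI
  by_contra h
  have hne : (Submodule.span A {a}).annihilator ≠ ⊤ := by
    rw [Ne, Submodule.annihilator_eq_top_iff, Submodule.span_singleton_eq_bot]
    exact h
  obtain ⟨m, hm, hle⟩ := Ideal.exists_le_maximal _ hne
  let := Ideal.Quotient.field m
  have hbij : Function.Bijective (algebraMap k (A ⧸ m)) :=
    IsAlgClosed.algebraMap_bijective_of_isIntegral
  let ε : k ≃ₐ[k] A ⧸ m := AlgEquiv.ofBijective (Algebra.ofId k (A ⧸ m)) hbij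
  let g : A →ₐ[k] k := ε.symm.toAlgHom.comp (Ideal.Quotient.mkₐ k m)
  obtain ⟨e', hge, hae'⟩ := exists_point_idempotent he hae g
  have hmem : e' ∈ (Submodule.span A {a}).annihilator := by
    rw [Submodule.mem_annihilator_span_singleton, smul_eq_mul, mul_comm, hae', ha, map_zero,
      zero_mul]
  have h0 : g e' = 0 := by
    simp [g, Ideal.Quotient.eq_zero_iff_mem.mpr (hle hmem)]
  exact one_ne_zero (hge.symm.trans h0)

theorem liftGroupLikeBialgHom_eq_linearCombination
    (x : MonoidAlgebra k (GroupLike k (HopfDual k A))) :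
    MonoidAlgebra.liftGroupLikeBialgHom x = Finsupp.linearCombination k GroupLike.val x.coeff :=
  MonoidAlgebra.lift_apply _ x

/-- If the `k`-points separate the elements of `A`, then `A*` is the group algebra of its group-like
elements. Group-like elements are always linearly independent, and here they span, since the points
are among them. -/
theorem bijective_liftGroupLikeBialgHom
    (h : ∀ a : A, (∀ g : A →ₐ[k] k, g a = 0) → a = 0) :
    Function.Bijective (MonoidAlgebra.liftGroupLikeBialgHom (R := k) (A := HopfDual k A)) := by
  constructor
  · intro x y hxy
    apply MonoidAlgebra.coeff_injective
    apply linearIndep_groupLikeVal (R := k) (A := HopfDual k A)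
    simpa only [liftGroupLikeBialgHom_eq_linearCombination] using hxy
  · let M : Submodule k (Module.Dual k A) :=
      (LinearMap.range (MonoidAlgebra.liftGroupLikeBialgHom (R := k)
        (A := HopfDual k A)).toLinearMap).map (HopfDual.equivDual k A).toLinearMap
    have hM : M.dualCoannihilator = ⊥ := by
      refine (Submodule.eq_bot_iff _).mpr fun a ha ↦ h a fun g ↦ ?_
      rw [Submodule.mem_dualCoannihilator] at ha
      exact ha g.toLinearMap ⟨(HopfDual.ofPoint g).val, ⟨MonoidAlgebra.of k _ (HopfDual.ofPoint g),
        (liftGroupLikeBialgHom_eq_linearCombination _).trans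
          ((Finsupp.linearCombination_single k 1 _).trans (one_smul k _))⟩, rfl⟩
    have hM' : M = ⊤ := by
      rw [← Subspace.dualCoannihilator_dualAnnihilator_eq (W := M), hM,
        Submodule.dualAnnihilator_bot]
    intro f
    obtain ⟨_, ⟨x, rfl⟩, hx⟩ := (hM' ▸ Submodule.mem_top : HopfDual.equivDual k A f ∈ M)
    exact ⟨x, (HopfDual.equivDual k A).injective hx⟩

theorem finite_groupLike : Finite (GroupLike k (HopfDual k A)) :=
  (linearIndep_groupLikeVal (R := k) (A := HopfDual k A)).finite

theorem adjoin_range_groupLike_eq_top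
    (hΨ : Function.Surjective (MonoidAlgebra.liftGroupLikeBialgHom (R := k) (A := HopfDual k A))) :
    Algebra.adjoin k (Set.range (GroupLike.val (R := k) (A := HopfDual k A))) = ⊤ := by
  rw [eq_top_iff]
  intro f _
  obtain ⟨x, rfl⟩ := hΨ f
  rw [liftGroupLikeBialgHom_eq_linearCombination]
  refine sum_mem fun g _ ↦ Subalgebra.smul_mem _ ?_ _
  exact Algebra.subset_adjoin (Set.mem_range_self g)

/-- The dual of the Hopf algebra of a simple group scheme is not reduced to the scalars. -/
theorem IsSimpleHopf.not_top_le_bot (hA : IsSimpleHopf k A) :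
    ¬ (⊤ : Subalgebra k (HopfDual k A)) ≤ ⊥ := by
  refine fun h ↦ hA.ker_counit_ne_bot ((Submodule.eq_bot_iff _).mpr fun a ha ↦ ?_)
  refine HopfDual.eq_of_forall_apply_eq (k := k) fun f ↦ ?_
  obtain ⟨c, rfl⟩ := h (Algebra.mem_top (x := f))
  have h1 : counit (R := k) a = 0 := ha
  rw [map_zero]
  exact (HopfDual.algebraMap_apply c a).trans (by rw [h1, mul_zero])

theorem IsSimpleHopf.isSimpleGroup_groupLike (hA : IsSimpleHopf k A)
    (hΨ : Function.Surjective (MonoidAlgebra.liftGroupLikeBialgHom (R := k) (A := HopfDual k A))) :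
    IsSimpleGroup (GroupLike k (HopfDual k A)) where
  exists_pair_ne := by
    by_contra! h
    refine hA.not_top_le_bot ?_
    rw [← adjoin_range_groupLike_eq_top hΨ]
    refine Algebra.adjoin_le ?_
    rintro _ ⟨g, rfl⟩
    rw [h g 1]
    exact one_mem _
  eq_bot_or_eq_top_of_normal N hN := by
    let S : Submonoid (HopfDual k A) := N.toSubmonoid.map (GroupLike.valMonoidHom k (HopfDual k A))
    have hmem {g : GroupLike k (HopfDual k A)} (hg : g ∈ N) :
        g.val ∈ Algebra.adjoin k (S : Set _) :=
      Algebra.subset_adjoin ⟨g, hg, rfl⟩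
    have hspan {g : GroupLike k (HopfDual k A)} (hg : g.val ∈ Algebra.adjoin k (S : Set _)) :
        g ∈ N := by
      rw [← Subalgebra.mem_toSubmodule, Algebra.adjoin_eq_span, Submonoid.closure_eq] at hg
      by_contra hgN
      exact (linearIndep_groupLikeVal (R := k) (A := HopfDual k A)).notMem_span_image
        (s := N) hgN hg
    refine (hA.adjoin_eq_bot_or_eq_top (S := S) ?_ ?_ (adjoin_range_groupLike_eq_top hΨ) ?_).imp
      (fun h ↦ ?_) fun h ↦ ?_
    · rintro _ ⟨g, hg, rfl⟩
      refine ⟨⟨g.val, hmem hg⟩ ⊗ₜ ⟨g.val, hmem hg⟩, ?_⟩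
      exact g.isGroupLikeElem_val.comul_eq_tmul_self.symm
    · rintro _ ⟨g, hg, rfl⟩
      exact hmem (N.inv_mem hg)
    · rintro _ ⟨g, rfl⟩ b hb
      rw [HopfDual.adj, g.isGroupLikeElem_val.comul_eq_tmul_self, HopfDual.sandwich_tmul]
      induction hb using Algebra.adjoin_induction with
      | mem x hx =>
        obtain ⟨n, hn, rfl⟩ := hx
        exact hmem (hN.conj_mem n hn g)
      | algebraMap c =>
        rw [← Algebra.commutes, mul_assoc, g.isGroupLikeElem_val.mul_antipode_cancel, mul_one]
        exact Subalgebra.algebraMap_mem _ c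
      | add x y _ _ hx hy =>
        rw [mul_add, add_mul]
        exact add_mem hx hy
      | mul x y _ _ hx hy =>
        have h1 : g.val * (x * y) * antipode k g.val =
            g.val * x * antipode k g.val * (g.val * y * antipode k g.val) := by
          rw [mul_assoc (g.val * x), ← mul_assoc (antipode k g.val), ← mul_assoc (antipode k g.val),
            g.isGroupLikeElem_val.antipode_mul_cancel, one_mul]
          simp only [mul_assoc]
        rw [h1]
        exact mul_mem hx hy
    · rw [eq_bot_iff]
      intro g hg
      obtain ⟨c, hc⟩ := h ▸ hmem hg
      have h1 := g.isGroupLikeElem_val.counit_eq_one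
      rw [← hc] at h1
      have h2 : c = 1 := (Bialgebra.counit_algebraMap (R := k) (A := HopfDual k A) c).symm.trans h1
      refine GroupLike.val_injective ?_
      rw [← hc, h2]
      exact map_one _
    · rw [eq_top_iff]
      intro g _
      exact hspan (h ▸ Algebra.mem_top)

end Etale

/-! ### Jacobson's formula -/

section Jacobson

open Polynomial

attribute [local instance 100] LieRing.ofAssociativeRing

theorem Nat.Prime.cast_choose_pred {p : ℕ} (hp : p.Prime) {R : Type*} [Ring R] (h : (p : R) = 0)
    {i : ℕ} (hi : i < p) : ((p - 1).choose i : R) = (-1) ^ i := by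
  induction i with
  | zero => simp
  | succ i ih =>
    have h1 : p.choose (i + 1) = (p - 1).choose i + (p - 1).choose (i + 1) := by
      rw [← Nat.choose_succ_succ, Nat.succ_eq_add_one, Nat.sub_add_cancel hp.one_le]
    obtain ⟨c, hc⟩ := hp.dvd_choose_self (Nat.succ_ne_zero i) hi
    have h2 := congr((Nat.cast $h1 : R))
    rw [Nat.succ_eq_add_one] at hc
    rw [hc, Nat.cast_mul, h, zero_mul, Nat.cast_add, ih (by omega)] at h2
    rw [pow_succ, mul_neg_one]
    exact (neg_eq_of_add_eq_zero_right h2.symm).symm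

theorem Commute.sub_pow_prime_pred {p : ℕ} (hp : p.Prime) {R : Type*} [Ring R] (h : (p : R) = 0)
    {a b : R} (hab : Commute a b) :
    (a - b) ^ (p - 1) = ∑ i ∈ Finset.range p, a ^ i * b ^ (p - 1 - i) := by
  rw [sub_eq_add_neg, hab.neg_right.add_pow, Nat.sub_add_cancel hp.one_le]
  refine Finset.sum_congr rfl fun i hi ↦ ?_
  have hi := Finset.mem_range.mp hi
  rw [← Nat.choose_symm (by omega), hp.cast_choose_pred h (by omega), mul_assoc,
    ← (Commute.neg_one_right (-b)).mul_pow]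
  simp

theorem Polynomial.derivative_pow_eq_sum {R : Type*} [Semiring R] (z : R[X]) (n : ℕ) :
    derivative (z ^ n) = ∑ i ∈ Finset.range n, z ^ i * derivative z * z ^ (n - 1 - i) := by
  induction n with
  | zero => simp
  | succ n ih =>
    rw [pow_succ, derivative_mul, ih, Finset.sum_range_succ, Finset.sum_mul]
    congr 1
    · refine Finset.sum_congr rfl fun i hi ↦ ?_
      have hi := Finset.mem_range.mp hi
      rw [mul_assoc, ← pow_succ]
      congr 2
      omega
    · simp

variable {p : ℕ} {k H : Type*} [Field k] [Ring H] [Algebra k H]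

/-- Expansion of `ad (x₀ X + x₁) ^ m` applied to a constant polynomial. -/
theorem adjoint_pow_C_eq_sum (x₀ x₁ w : H) (m : ℕ) :
    ((LinearMap.mulLeft k (C x₀ * X + C x₁) - LinearMap.mulRight k (C x₀ * X + C x₁) :
      Module.End k H[X]) ^ m) (C w) =
      ∑ u : Fin m → Fin 2, C ((List.ofFn fun j ↦ LieAlgebra.ad k H (![x₀, x₁] (u j))).prod w) *
        X ^ (Finset.univ.filter (u · = 0)).card := by
  induction m with
  | zero => simp
  | succ m ih =>
    rw [pow_succ', Module.End.mul_apply, ih, map_sum,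
      ← (Fin.consEquiv fun _ ↦ Fin 2).sum_comp, Fintype.sum_prod_type, Fin.sum_univ_two,
      ← Finset.sum_add_distrib]
    refine Finset.sum_congr rfl fun u _ ↦ ?_
    have h0 (i : Fin 2) : (Finset.univ.filter ((Fin.cons i u : Fin (m + 1) → Fin 2) · = 0)).card =
        (if i = 0 then 1 else 0) + (Finset.univ.filter (u · = 0)).card := by
      rw [Finset.card_filter, Finset.card_filter, Fin.sum_univ_succ]
      rfl
    simp only [Fin.consEquiv_apply, h0, List.ofFn_succ, Fin.cons_zero, Fin.cons_succ,
      List.prod_cons, Module.End.mul_apply, LieAlgebra.ad_apply,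
      LieRing.of_associative_ring_bracket]
    set v := (List.ofFn fun j ↦ LieAlgebra.ad k H (![x₀, x₁] (u j))).prod w
    set c := (Finset.univ.filter (u · = 0)).card
    have h1 (a : H) : C v * X ^ c * (C a * X) = C (v * a) * X ^ (1 + c) := by
      rw [mul_assoc, ← mul_assoc (X ^ c), X_pow_mul_C, C_mul, mul_assoc, mul_assoc, ← pow_succ,
        add_comm]
    have h2 (a : H) : C a * X * (C v * X ^ c) = C (a * v) * X ^ (1 + c) := by
      rw [mul_assoc, ← mul_assoc X, X_mul_C, C_mul, mul_assoc, mul_assoc, ← pow_succ', add_comm]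
    have h3 (a : H) : C v * X ^ c * C a = C (v * a) * X ^ c := by
      rw [mul_assoc, X_pow_mul_C, C_mul, mul_assoc]
    have h4 (a : H) : C a * (C v * X ^ c) = C (a * v) * X ^ c := by rw [C_mul, mul_assoc]
    simp [mul_add, add_mul, h1, h2, h3, h4, sub_mul, -map_mul]
    abel

/-- The Jacobson terms are the middle coefficients of `(x₀ X + x₁) ^ p`. -/
theorem jacobsonTerm_eq_coeff [Fact p.Prime] [CharP k p] (x₀ x₁ : H) {r : ℕ}
    (hr : r ∈ Finset.Icc 1 (p - 1)) :
    jacobsonTerm p k r x₀ x₁ = ((C x₀ * X + C x₁) ^ p).coeff r := by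
  have hp : p.Prime := Fact.out
  obtain ⟨hr1, hr2⟩ := Finset.mem_Icc.mp hr
  set z : H[X] := C x₀ * X + C x₁ with hz
  set D : Module.End k H[X] := LinearMap.mulLeft k z - LinearMap.mulRight k z with hD
  have hpE : (p : Module.End k H[X]) = 0 := by
    rw [← map_natCast (algebraMap k (Module.End k H[X])), CharP.cast_eq_zero, map_zero]
  -- the derivative of `z ^ p` is `∑ z ^ i * x₀ * z ^ (p - 1 - i)`, which in characteristic `p` is
  -- `ad z ^ (p - 1)` applied to `x₀`
  have hder : derivative (z ^ p) = (D ^ (p - 1)) (C x₀) := by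
    rw [derivative_pow_eq_sum, hD, (LinearMap.commute_mulLeft_right z z).sub_pow_prime_pred hp hpE]
    simp [LinearMap.pow_mulLeft, LinearMap.pow_mulRight, hz, mul_assoc]
  have hX (w : H[X]) (m : ℕ) : (D ^ m) (w * X) = (D ^ m) w * X := by
    induction m with
    | zero => simp
    | succ m ih =>
      simp only [pow_succ', Module.End.mul_apply, ih]
      simp [hD, sub_mul, mul_assoc, X_mul]
  have hDz : (D ^ (p - 1)) z = 0 := by
    obtain ⟨m, hm⟩ : ∃ m, p - 1 = m + 1 := ⟨p - 2, by omega⟩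
    rw [hm, pow_succ, Module.End.mul_apply]
    simp [hD]
  -- since `ad z` kills `z = x₀ X + x₁`, the same derivative can be computed from `x₁`
  have h1 : (D ^ (p - 1)) (C x₁) = -(derivative (z ^ p) * X) := by
    rw [hder, ← hX, eq_neg_iff_add_eq_zero, add_comm, ← map_add]
    exact hDz
  have h2 := congr(($h1).coeff r)
  obtain ⟨s, rfl⟩ : ∃ s, r = s + 1 := ⟨r - 1, by omega⟩
  rw [adjoint_pow_C_eq_sum] at h2
  simp only [finsetSum_coeff, coeff_C_mul_X_pow, coeff_neg, coeff_mul_X, coeff_derivative] at h2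
  rw [jacobsonTerm, Finset.sum_filter]
  simp only [eq_comm (a := s + 1)] at h2
  have hne : ((s + 1 : ℕ) : k) ≠ 0 := by
    rw [Ne, CharP.cast_eq_zero_iff k p]
    intro h
    have := Nat.le_of_dvd (by omega) h
    omega
  rw [h2, neg_eq_iff_eq_neg, smul_neg, neg_inj, inv_smul_eq_iff₀ hne, Nat.cast_smul_eq_nsmul,
    nsmul_eq_mul', Nat.cast_add_one]

/-- Jacobson's formula in an associative algebra of characteristic `p`. -/
theorem add_pow_eq_jacobson [Fact p.Prime] [CharP k p] (x₀ x₁ : H) :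
    (x₀ + x₁) ^ p = x₀ ^ p + x₁ ^ p + ∑ r ∈ Finset.Icc 1 (p - 1), jacobsonTerm p k r x₀ x₁ := by
  have hp : p.Prime := Fact.out
  set z : H[X] := C x₀ * X + C x₁ with hz
  have h1 : (x₀ + x₁) ^ p = ∑ r ∈ Finset.range (p + 1), (z ^ p).coeff r := by
    have h2 := map_pow (eval₂RingHom' (RingHom.id H) 1 fun a ↦ Commute.one_right a) z p
    have hdeg : (z ^ p).natDegree < p + 1 := by
      refine Nat.lt_succ_of_le (natDegree_pow_le.trans ?_)
      have : z.natDegree ≤ 1 := by rw [hz]; compute_degree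
      nlinarith
    simp only [eval₂RingHom', RingHom.coe_mk, MonoidHom.coe_mk, OneHom.coe_mk] at h2
    rw [eval₂_eq_sum_range' _ hdeg] at h2
    simpa [hz] using h2.symm
  have h0 : (z ^ p).coeff 0 = x₁ ^ p := by
    have := map_pow (constantCoeff (R := H)) z p
    simpa [hz] using this
  have hpp : (z ^ p).coeff p = x₀ ^ p := by
    have := coeff_pow_of_natDegree_le (p := z) (m := p) (n := 1) (by rw [hz]; compute_degree)
    rw [mul_one] at this
    rw [this, hz]
    simp
  have := hp.pos
  rw [h1, Finset.sum_range_succ, hpp, Finset.sum_range_eq_add_Ico _ hp.pos, h0,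
    Finset.sum_congr rfl fun r hr ↦ jacobsonTerm_eq_coeff x₀ x₁ hr, ← hz,
    show Finset.Ico 1 p = Finset.Icc 1 (p - 1) by
      ext
      simp only [Finset.mem_Ico, Finset.mem_Icc]
      omega]
  abel

end Jacobson

section LieSubalgebra

attribute [local instance 100] LieRing.ofAssociativeRing

variable {p : ℕ} {k H : Type*} [Field k] [Ring H] [Algebra k H]

theorem LieSubalgebra.coe_prod_ad (L : LieSubalgebra k H) (l : List L) (w : L) :
    (((l.map (LieAlgebra.ad k L)).prod w : L) : H) =
      (l.map fun x : L ↦ LieAlgebra.ad k H x).prod w := by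
  induction l with
  | nil => simp
  | cons x l ih =>
    simp only [List.map_cons, List.prod_cons, Module.End.mul_apply, LieAlgebra.ad_apply,
      LieSubalgebra.coe_bracket, ih]

theorem LieSubalgebra.coe_jacobsonTerm (L : LieSubalgebra k H) (r : ℕ) (x₀ x₁ : L) :
    ((jacobsonTerm p k r x₀ x₁ : L) : H) = jacobsonTerm p k r (x₀ : H) (x₁ : H) := by
  have h (u : Fin (p - 1) → Fin 2) :
      (((List.ofFn fun j ↦ LieAlgebra.ad k L (![x₀, x₁] (u j))).prod x₁ : L) : H) =
        (List.ofFn fun j ↦ LieAlgebra.ad k H (![(x₀ : H), x₁] (u j))).prod x₁ := by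
    have h1 := L.coe_prod_ad (List.ofFn fun j ↦ ![x₀, x₁] (u j)) x₁
    rw [List.map_ofFn, List.map_ofFn] at h1
    have h2 (i : Fin 2) : ((![x₀, x₁] i : L) : H) = ![(x₀ : H), x₁] i := by
      fin_cases i <;> rfl
    simpa [Function.comp_def, h2] using h1
  simp only [jacobsonTerm, NegMemClass.coe_neg, SetLike.val_smul,
    AddSubmonoidClass.coe_finsetSum, h]

theorem LieAlgebra.ad_pow_char [Fact p.Prime] [CharP k p] (x : H) :
    LieAlgebra.ad k H (x ^ p) = LieAlgebra.ad k H x ^ p := by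
  rcases subsingleton_or_nontrivial H
  · exact LinearMap.ext fun _ ↦ Subsingleton.elim _ _
  have : CharP (Module.End k H) p :=
    charP_of_injective_algebraMap (algebraMap k (Module.End k H)).injective p
  rw [LieAlgebra.ad_eq_lmul_left_sub_lmul_right, Pi.sub_apply, Pi.sub_apply,
    sub_pow_char_of_commute p (LinearMap.commute_mulLeft_right x x), LinearMap.pow_mulLeft,
    LinearMap.pow_mulRight]

/-- A Lie subalgebra of an associative algebra of characteristic `p` that is closed under `p`-th
powers is a restricted Lie algebra, the `p`-map being the `p`-th power. -/
@[reducible]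
def LieSubalgebra.restrictedLieAlgebra [Fact p.Prime] [CharP k p] (L : LieSubalgebra k H)
    (hL : ∀ x ∈ L, x ^ p ∈ L) : RestrictedLieAlgebra p k L where
  pMap x := ⟨x ^ p, hL x x.2⟩
  ad_pMap x := by
    ext y
    rw [LieSubalgebra.coe_ad_pow, ← LieAlgebra.ad_pow_char]
    rfl
  pMap_smul a x := Subtype.ext (smul_pow a (x : H) p)
  pMap_add x₀ x₁ := Subtype.ext <| by
    simp only [AddMemClass.coe_add, AddSubmonoidClass.coe_finsetSum,
      LieSubalgebra.coe_jacobsonTerm]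
    exact add_pow_eq_jacobson (k := k) (x₀ : H) x₁

end LieSubalgebra

/-! ### Spanning by ordered monomials with bounded exponents -/

section Words

/-- A word in the letters of `ι` in which each letter `i` occurs exactly `s i` times. The order of
the letters is an arbitrary one. -/
def Finsupp.word {ι : Type*} (s : ι →₀ ℕ) : List ι := (Finsupp.toMultiset s).toList

theorem Finsupp.count_word {ι : Type*} [DecidableEq ι] (s : ι →₀ ℕ) (i : ι) :
    s.word.count i = s i := by
  rw [← Multiset.coe_count, Finsupp.word, Multiset.coe_toList, Finsupp.count_toMultiset]

variable {k H : Type*} [Field k] [Ring H] [Algebra k H] {W : Submodule k H}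

/-- If `W` is closed under commutators, rearranging a product of elements of `W` changes it only by
products with fewer factors. -/
theorem Submodule.prod_sub_prod_mem_of_perm (hW : ∀ x ∈ W, ∀ y ∈ W, x * y - y * x ∈ W)
    {l l' : List W} (h : l.Perm l') :
    (l.map (↑)).prod - (l'.map (↑)).prod ∈
      Submodule.span k {y : H | ∃ v : List W, v.length < l.length ∧ (v.map (↑)).prod = y} := by
  induction h with
  | nil => simp
  | @cons x l l' h ih =>
    rw [List.map_cons, List.prod_cons, List.map_cons, List.prod_cons, ← mul_sub]
    have := Submodule.mem_map_of_mem (f := LinearMap.mulLeft k (x : H)) ih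
    rw [Submodule.map_span] at this
    refine Submodule.span_mono ?_ this
    rintro _ ⟨_, ⟨v, hv, rfl⟩, rfl⟩
    exact ⟨x :: v, by simpa using hv, by simp⟩
  | swap x y l =>
    refine Submodule.subset_span ⟨⟨_, hW y y.2 x x.2⟩ :: l, by simp, ?_⟩
    simp [sub_mul, mul_assoc]
  | @trans l₁ l₂ l₃ h₁ h₂ ih₁ ih₂ =>
    rw [← h₁.length_eq] at ih₂
    simpa using add_mem ih₁ ih₂

theorem Submodule.prod_mem_span_words {ι : Type*} [Fintype ι] (b : Module.Basis ι k W)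
    (l : List W) :
    (l.map (↑)).prod ∈ Submodule.span k
      {y : H | ∃ v : List ι, v.length = l.length ∧ ((v.map b).map (↑)).prod = y} := by
  induction l with
  | nil => exact Submodule.subset_span ⟨[], by simp⟩
  | cons x l ih =>
    rw [List.map_cons, List.prod_cons]
    have hx : (x : H) = ∑ i, b.repr x i • (b i : H) := by
      conv_lhs => rw [← b.sum_repr x]
      simp only [AddSubmonoidClass.coe_finsetSum, Submodule.coe_smul]
    rw [hx, Finset.sum_mul]
    refine Submodule.sum_mem _ fun i _ ↦ ?_
    rw [smul_mul_assoc]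
    refine Submodule.smul_mem _ _ ?_
    have := Submodule.mem_map_of_mem (f := LinearMap.mulLeft k (b i : H)) ih
    rw [Submodule.map_span] at this
    refine Submodule.span_mono ?_ this
    rintro _ ⟨_, ⟨v, hv, rfl⟩, rfl⟩
    exact ⟨i :: v, by simpa using hv, by simp⟩

/-- The easy half of the Poincaré-Birkhoff-Witt theorem for restricted Lie algebras: products of
elements of `W` are combinations of monomials in a basis with exponents less than `p`, in a fixed
order. A product with too high an exponent is shortened by means of `x ^ p ∈ W`. -/
theorem Submodule.prod_mem_span_bounded_words {p : ℕ} (hp : 2 ≤ p)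
    (hW : ∀ x ∈ W, ∀ y ∈ W, x * y - y * x ∈ W) (hpow : ∀ x ∈ W, x ^ p ∈ W)
    {ι : Type*} [Fintype ι] (b : Module.Basis ι k W) (l : List W) :
    (l.map (↑)).prod ∈ Submodule.span k (Set.range fun β : ι → Fin p ↦
      (((Finsupp.equivFunOnFinite.symm fun i ↦ (β i : ℕ)).word.map b).map ((↑) : W → H)).prod) := by
  classical
  induction hm : l.length using Nat.strong_induction_on generalizing l with
  | _ m ih =>
  refine Submodule.span_le.mpr ?_ (Submodule.prod_mem_span_words b l)
  rintro _ ⟨v, hv, rfl⟩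
  have key {l' : List W} (h : (v.map b).Perm l')
      (hl' : (l'.map (↑)).prod ∈ Submodule.span k (Set.range fun β : ι → Fin p ↦
      (((Finsupp.equivFunOnFinite.symm fun i ↦ (β i : ℕ)).word.map b).map ((↑) : W → H)).prod)) :
      ((v.map b).map (↑)).prod ∈ Submodule.span k (Set.range fun β : ι → Fin p ↦
      (((Finsupp.equivFunOnFinite.symm fun i ↦ (β i : ℕ)).word.map b).map ((↑) : W → H)).prod) := by
    rw [← sub_add_cancel ((v.map b).map ((↑) : W → H)).prod (l'.map (↑)).prod]
    refine add_mem (Submodule.span_le.mpr ?_ (Submodule.prod_sub_prod_mem_of_perm hW h)) hl'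
    rintro _ ⟨w, hw, rfl⟩
    exact ih _ (by simpa [hv, hm] using hw) w rfl
  by_cases hc : ∀ i, v.count i < p
  · refine key (l' := ((Finsupp.equivFunOnFinite.symm fun i ↦ v.count i).word.map b)) ?_ ?_
    · refine List.Perm.map _ (List.perm_iff_count.mpr fun i ↦ ?_)
      rw [Finsupp.count_word]
      rfl
    · exact Submodule.subset_span ⟨fun i ↦ ⟨v.count i, hc i⟩, rfl⟩
  · push Not at hc
    obtain ⟨i, hi⟩ := hc
    have hsub : (List.replicate p i).Subperm v := by
      rw [List.subperm_ext_iff]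
      intro j hj
      obtain rfl := List.eq_of_mem_replicate hj
      simpa using hi
    have hperm : v.Perm (List.replicate p i ++ v.diff (List.replicate p i)) :=
      (List.subperm_append_diff_self_of_count_le (List.subperm_ext_iff.mp hsub)).symm
    refine key (hperm.map b) ?_
    have h1 := ih _ ?_ (⟨_, hpow (b i) (b i).2⟩ :: (v.diff (List.replicate p i)).map b) rfl
    · simpa using h1
    · have := hperm.length_eq
      simp at this ⊢
      omega

theorem Submodule.finrank_adjoin_le {p : ℕ} (hp : 2 ≤ p) [Module.Finite k W]
    (hW : ∀ x ∈ W, ∀ y ∈ W, x * y - y * x ∈ W) (hpow : ∀ x ∈ W, x ^ p ∈ W) :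
    Module.finrank k (Algebra.adjoin k (W : Set H)) ≤ p ^ Module.finrank k W := by
  let b := Module.finBasis k W
  have h : Subalgebra.toSubmodule (Algebra.adjoin k (W : Set H)) ≤
      Submodule.span k (Set.range fun β : Fin (Module.finrank k W) → Fin p ↦
      (((Finsupp.equivFunOnFinite.symm fun i ↦ (β i : ℕ)).word.map b).map ((↑) : W → H)).prod) := by
    rw [Algebra.adjoin_eq_span, Submodule.span_le]
    intro x hx
    obtain ⟨l, hl, rfl⟩ := Submonoid.exists_list_of_mem_closure hx
    lift l to List W using hl
    exact Submodule.prod_mem_span_bounded_words hp hW hpow b l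
  have hfin := FiniteDimensional.span_of_finite k
    (Set.finite_range fun β : Fin (Module.finrank k W) → Fin p ↦
      (((Finsupp.equivFunOnFinite.symm fun i ↦ (β i : ℕ)).word.map b).map ((↑) : W → H)).prod)
  calc Module.finrank k (Algebra.adjoin k (W : Set H)) ≤ _ := Submodule.finrank_mono h
    _ ≤ _ := finrank_range_le_card _
    _ = _ := by simp

end Words

/-! ### Primitive elements and derivations -/

section Primitives

open Coalgebra HopfAlgebra

attribute [local instance 100] LieRing.ofAssociativeRing

/-- The Lie algebra of primitive elements of a bialgebra. -/
def primitives (k H : Type*) [Field k] [Ring H] [Bialgebra k H] : LieSubalgebra k H where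
  carrier := {f | comul (R := k) f = f ⊗ₜ 1 + 1 ⊗ₜ f}
  add_mem' {f g} (hf hg) := by
    change comul (R := k) f = _ at hf
    change comul (R := k) g = _ at hg
    change comul (R := k) (f + g) = _
    rw [map_add, hf, hg, TensorProduct.add_tmul, TensorProduct.tmul_add]
    abel
  zero_mem' := by simp
  smul_mem' c f hf := by
    change comul (R := k) f = _ at hf
    change comul (R := k) (c • f) = _
    rw [map_smul, hf, smul_add, TensorProduct.smul_tmul', TensorProduct.tmul_smul]
  lie_mem' {f g} hf hg := by
    change comul (R := k) f = _ at hf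
    change comul (R := k) g = _ at hg
    rw [LieRing.of_associative_ring_bracket]
    change comul (R := k) (f * g - g * f) = _
    rw [map_sub, Bialgebra.comul_mul, Bialgebra.comul_mul, hf, hg]
    simp only [mul_add, add_mul, Algebra.TensorProduct.tmul_mul_tmul, mul_one, one_mul,
      TensorProduct.sub_tmul, TensorProduct.tmul_sub]
    abel

theorem mem_primitives {k H : Type*} [Field k] [Ring H] [Bialgebra k H] {f : H} :
    f ∈ primitives k H ↔ comul (R := k) f = f ⊗ₜ 1 + 1 ⊗ₜ f := Iff.rfl

theorem pow_char_mem_primitives (p : ℕ) [Fact p.Prime] {k H : Type*} [Field k] [CharP k p] [Ring H]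
    [Bialgebra k H] {f : H} (hf : f ∈ primitives k H) : f ^ p ∈ primitives k H := by
  rw [mem_primitives] at hf ⊢
  rcases subsingleton_or_nontrivial (H ⊗[k] H)
  · exact Subsingleton.elim _ _
  have : CharP (H ⊗[k] H) p := charP_of_injective_algebraMap (algebraMap k _).injective p
  have hc : Commute (f ⊗ₜ[k] (1 : H)) ((1 : H) ⊗ₜ[k] f) := by simp [commute_iff_eq]
  rw [Bialgebra.comul_pow, hf, add_pow_char_of_commute _ hc]
  simp

variable {k A : Type u} [Field k] [CommRing A] [HopfAlgebra k A]

namespace HopfDual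

/-- The linear map `a ↦ ∑ f a₍₁₎ • a₍₂₎`, through which `f` acts on `A`. -/
def contract (f : HopfDual k A) : A →ₗ[k] A :=
  (TensorProduct.lid k A).toLinearMap ∘ₗ (equivDual k A f).rTensor A ∘ₗ comul

theorem mul_apply_eq_apply_contract (f g : HopfDual k A) (a : A) :
    (f * g) a = g (contract f a) := by
  rw [mul_repr _ _ (ℛ k a), contract, LinearMap.comp_apply, LinearMap.comp_apply, ← (ℛ k a).eq]
  simp

theorem counit_contract (f : HopfDual k A) (a : A) : counit (R := k) (contract f a) = f a := by
  have h := mul_apply_eq_apply_contract f 1 a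
  rw [mul_one] at h
  exact h.symm

variable [Module.Finite k A]

theorem mem_primitives_iff {f : HopfDual k A} : f ∈ primitives k (HopfDual k A) ↔
    ∀ a b : A, f (a * b) = f a * counit (R := k) b + counit (R := k) a * f b := by
  rw [mem_primitives, comul_def]
  constructor
  · intro h a b
    rw [← tensorEquiv_comulMap, h]
    simp
  · intro h
    refine tensor_ext fun a b ↦ ?_
    rw [tensorEquiv_comulMap, h]
    simp

theorem apply_one_of_mem_primitives {f : HopfDual k A} (hf : f ∈ primitives k (HopfDual k A)) :
    f 1 = 0 := by
  have := mem_primitives_iff.mp hf 1 1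
  simpa using this

theorem antipode_of_mem_primitives {f : HopfDual k A} (hf : f ∈ primitives k (HopfDual k A)) :
    antipode k f = -f := by
  have h := mul_antipode_rTensor_comul_apply (R := k) f
  rw [mem_primitives.mp hf, counit_def, apply_one_of_mem_primitives hf] at h
  simpa [add_eq_zero_iff_eq_neg] using h

/-- A primitive element of the dual acts on `A` by a derivation. -/
theorem contract_mul {f : HopfDual k A} (hf : f ∈ primitives k (HopfDual k A)) (a b : A) :
    contract f (a * b) = a * contract f b + contract f a * b := by
  have h (s t : A ⊗[k] A) :
      TensorProduct.lid k A ((equivDual k A f).rTensor A (s * t)) =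
        TensorProduct.lid k A ((counit (R := k) (A := A)).rTensor A s) *
          TensorProduct.lid k A ((equivDual k A f).rTensor A t) +
        TensorProduct.lid k A ((equivDual k A f).rTensor A s) *
          TensorProduct.lid k A ((counit (R := k) (A := A)).rTensor A t) := by
    induction s with
    | zero => simp
    | add x y hx hy => simp only [add_mul, map_add, hx, hy]; abel
    | tmul a a' =>
      induction t with
      | zero => simp
      | add x y hx hy => simp only [mul_add, map_add, hx, hy]; abel
      | tmul b b' =>
        simp only [Algebra.TensorProduct.tmul_mul_tmul, LinearMap.rTensor_tmul,
          TensorProduct.lid_tmul, mem_primitives_iff.mp hf, smul_mul_smul_comm, ← add_smul]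
        rw [add_comm]
  have h1 (a : A) : TensorProduct.lid k A ((counit (R := k) (A := A)).rTensor A (comul a)) = a := by
    rw [rTensor_counit_comul]
    simp
  have h2 := h (comul a) (comul b)
  rw [← Bialgebra.comul_mul, h1, h1] at h2
  exact h2

/-- A derivation maps the `(n + 1)`-st power of an ideal into the `n`-th. -/
theorem contract_mem_pow {f : HopfDual k A} (hf : f ∈ primitives k (HopfDual k A)) (I : Ideal A)
    {n : ℕ} {a : A} (ha : a ∈ I ^ (n + 1)) : contract f a ∈ I ^ n := by
  induction n generalizing a with
  | zero => simp
  | succ n ih =>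
    rw [pow_succ] at ha
    induction ha using Submodule.mul_induction_on' with
    | mem_mul_mem a ha b hb =>
      rw [contract_mul hf]
      refine add_mem (Ideal.mul_mem_right _ _ ha) ?_
      rw [pow_succ]
      exact Ideal.mul_mem_mul (ih ha) hb
    | add a _ b _ ha hb => rw [map_add]; exact add_mem ha hb

/-- A product of `n` primitive elements vanishes on the `(n + 1)`-st power of the augmentation
ideal. -/
theorem prod_apply_eq_zero (l : List (HopfDual k A)) (hl : ∀ f ∈ l, f ∈ primitives k (HopfDual k A))
    {a : A} (ha : a ∈ RingHom.ker (Bialgebra.counitAlgHom k A) ^ (l.length + 1)) :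
    l.prod a = 0 := by
  induction l generalizing a with
  | nil => simpa using ha
  | cons f l ih =>
    rw [List.prod_cons, mul_apply_eq_apply_contract]
    exact ih (fun g hg ↦ hl g (List.mem_cons_of_mem _ hg))
      (contract_mem_pow (hl f List.mem_cons_self) _ ha)

end HopfDual

end Primitives

/-! ### Independence of ordered monomials in the primitive elements -/

section DualSystem

open Coalgebra HopfAlgebra

variable {k A : Type u} [Field k] [CommRing A] [HopfAlgebra k A] [Module.Finite k A]

namespace HopfDual

/-- A family of primitive elements `D i` of the dual and a family of elements `x i` of the
augmentation ideal that are dual to each other. -/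
structure IsDualSystem {ι : Type*} [DecidableEq ι] (D : ι → HopfDual k A) (x : ι → A) : Prop where
  mem_primitives (i : ι) : D i ∈ primitives k (HopfDual k A)
  mem_ker_counit (i : ι) : x i ∈ RingHom.ker (Bialgebra.counitAlgHom k A)
  apply_eq (i j : ι) : D i (x j) = if i = j then 1 else 0

namespace IsDualSystem

variable {ι : Type*} [DecidableEq ι] {D : ι → HopfDual k A} {x : ι → A}

theorem prod_map_mem_pow (h : IsDualSystem D x) (v : Multiset ι) :
    (v.map x).prod ∈ RingHom.ker (Bialgebra.counitAlgHom k A) ^ v.card := by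
  induction v using Multiset.induction with
  | empty => simp
  | cons j v ih =>
    rw [Multiset.map_cons, Multiset.prod_cons, Multiset.card_cons, pow_succ']
    exact Ideal.mul_mem_mul (h.mem_ker_counit j) ih

/-- To leading order, `D i` acts on a monomial in the `x j` as the partial derivative with respect
to `x i`. -/
theorem contract_prod_sub_mem (h : IsDualSystem D x) (i : ι) (v : Multiset ι) :
    contract (D i) (v.map x).prod - v.count i • ((v.erase i).map x).prod ∈
      RingHom.ker (Bialgebra.counitAlgHom k A) ^ v.card := by
  induction v using Multiset.induction with
  | empty => simp
  | cons j v ih =>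
    have h1 : contract (D i) (x j) - (if i = j then 1 else 0) ∈
        RingHom.ker (Bialgebra.counitAlgHom k A) := by
      have h2 := counit_contract (D i) (x j)
      rw [h.apply_eq] at h2
      rw [RingHom.mem_ker, map_sub]
      change counit (R := k) _ - _ = 0
      rw [h2]
      split_ifs <;> simp
    have h3 : contract (D i) ((j ::ₘ v).map x).prod -
          (j ::ₘ v).count i • (((j ::ₘ v).erase i).map x).prod =
        x j * (contract (D i) (v.map x).prod - v.count i • ((v.erase i).map x).prod) +
          (contract (D i) (x j) - (if i = j then 1 else 0)) * (v.map x).prod := by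
      rw [Multiset.map_cons, Multiset.prod_cons, contract_mul (h.mem_primitives i)]
      by_cases hij : i = j
      · subst hij
        rw [Multiset.count_cons_self, Multiset.erase_cons_head, if_pos rfl]
        by_cases hi : i ∈ v
        · rw [← Multiset.cons_erase hi, Multiset.map_cons, Multiset.prod_cons]
          simp only [nsmul_eq_mul, Multiset.erase_cons_head]
          push_cast
          ring
        · rw [Multiset.count_eq_zero_of_notMem hi]
          simp only [nsmul_eq_mul]
          push_cast
          ring
      · rw [Multiset.count_cons_of_ne hij, Multiset.erase_cons_tail _ (Ne.symm hij), if_neg hij,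
          Multiset.map_cons, Multiset.prod_cons]
        simp only [nsmul_eq_mul]
        ring
    rw [h3, Multiset.card_cons, pow_succ']
    exact add_mem (Ideal.mul_mem_mul (h.mem_ker_counit j) ih)
      (Ideal.mul_mem_mul h1 (h.prod_map_mem_pow v))

theorem prod_cons_apply (h : IsDualSystem D x) (i : ι) (l : List ι) {v : Multiset ι}
    (hv : v.card = l.length + 1) :
    ((i :: l).map D).prod (v.map x).prod =
      v.count i * (l.map D).prod ((v.erase i).map x).prod := by
  rw [List.map_cons, List.prod_cons, mul_apply_eq_apply_contract, ← sub_eq_zero, ← nsmul_eq_mul,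
    ← map_nsmul, ← map_sub]
  refine prod_apply_eq_zero _ (fun f hf ↦ ?_) ?_
  · obtain ⟨j, -, rfl⟩ := List.mem_map.mp hf
    exact h.mem_primitives j
  · rw [List.length_map, ← hv]
    exact h.contract_prod_sub_mem i v

theorem prod_apply_eq_zero_of_ne (h : IsDualSystem D x) {l : List ι} {v : Multiset ι}
    (hv : v.card = l.length) (hne : (l : Multiset ι) ≠ v) :
    (l.map D).prod (v.map x).prod = 0 := by
  induction l generalizing v with
  | nil => exact absurd (Multiset.card_eq_zero.mp hv).symm hne
  | cons i l ih =>
    rw [h.prod_cons_apply i l hv]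
    by_cases hi : i ∈ v
    · rw [ih, mul_zero]
      · rw [Multiset.card_erase_of_mem hi, hv]
        rfl
      · intro h1
        apply hne
        rw [← Multiset.cons_coe, h1, Multiset.cons_erase hi]
    · rw [Multiset.count_eq_zero_of_notMem hi, Nat.cast_zero, zero_mul]

theorem prod_apply_ne_zero {p : ℕ} [CharP k p] (h : IsDualSystem D x) {l : List ι}
    (hl : ∀ i, l.count i < p) : (l.map D).prod ((l : Multiset ι).map x).prod ≠ 0 := by
  induction l with
  | nil => simp
  | cons i l ih =>
    rw [h.prod_cons_apply i l (by simp), ← Multiset.cons_coe, Multiset.erase_cons_head]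
    refine mul_ne_zero ?_ (ih fun j ↦ (List.count_le_count_cons).trans_lt (hl j))
    rw [Ne, CharP.cast_eq_zero_iff k p, Multiset.cons_coe, Multiset.coe_count]
    exact Nat.not_dvd_of_pos_of_lt (by simp) (hl i)

/-- The ordered monomials in the `D i` with exponents less than `p` are linearly independent, since
evaluating them on the monomials in the `x i` gives a triangular matrix. -/
theorem linearIndependent {p : ℕ} [CharP k p] [Fintype ι] (h : IsDualSystem D x) :
    LinearIndependent k fun β : ι → Fin p ↦
      ((Finsupp.equivFunOnFinite.symm fun i ↦ (β i : ℕ)).word.map D).prod := by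
  classical
  let w (β : ι → Fin p) : List ι := (Finsupp.equivFunOnFinite.symm fun i ↦ (β i : ℕ)).word
  have hw (β : ι → Fin p) (i : ι) : (w β).count i = β i := Finsupp.count_word _ i
  have hinj {β γ : ι → Fin p} (hβγ : (w β : Multiset ι) = w γ) : β = γ := by
    funext i
    rw [Fin.ext_iff, ← hw, ← hw, (Multiset.coe_eq_coe.mp hβγ).count_eq]
  rw [Fintype.linearIndependent_iff]
  intro c hc
  by_contra! hne
  -- evaluate at the monomial of a longest word that has a nonzero coefficient
  obtain ⟨β, hβ, hmax⟩ := (Finset.univ.filter fun β ↦ c β ≠ 0).exists_max_image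
    (fun β ↦ (w β).length) (by simpa [Finset.Nonempty] using hne)
  simp only [Finset.mem_filter, Finset.mem_univ, true_and] at hβ hmax
  have h0 := congr(equivDual k A $hc (((w β : Multiset ι)).map x).prod)
  rw [map_sum, LinearMap.sum_apply, Finset.sum_eq_single β] at h0
  · rw [map_smul, LinearMap.smul_apply, smul_eq_mul, map_zero, LinearMap.zero_apply] at h0
    exact mul_ne_zero hβ (h.prod_apply_ne_zero fun i ↦ (hw β i).trans_lt (β i).2) h0
  · intro γ _ hγ
    rw [map_smul, LinearMap.smul_apply, smul_eq_mul]
    by_cases hcγ : c γ = 0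
    · rw [hcγ, zero_mul]
    rcases (hmax γ hcγ).lt_or_eq with hlt | heq
    · refine mul_eq_zero_of_right _ (prod_apply_eq_zero _ (fun f hf ↦ ?_) ?_)
      · obtain ⟨j, -, rfl⟩ := List.mem_map.mp hf
        exact h.mem_primitives j
      · refine Ideal.pow_le_pow_right ?_ (h.prod_map_mem_pow _)
        rw [List.length_map]
        exact hlt
    · exact mul_eq_zero_of_right _ (h.prod_apply_eq_zero_of_ne heq.symm fun h1 ↦ hγ (hinj h1))
  · simp

end IsDualSystem

end HopfDual

end DualSystem

/-! ### Hopf algebras of height one -/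

section HeightOne

open Coalgebra HopfAlgebra

attribute [local instance 100] LieRing.ofAssociativeRing

variable {k A : Type u} [Field k] [CommRing A] [HopfAlgebra k A] [Module.Finite k A]

namespace HopfDual

/-- A basis of the primitive elements is part of a dual system, because linearly independent linear
forms take arbitrary values. -/
theorem exists_isDualSystem {ι : Type*} [Finite ι] [DecidableEq ι]
    (b : Module.Basis ι k (primitives k (HopfDual k A))) :
    ∃ x : ι → A, IsDualSystem (fun i ↦ (b i : HopfDual k A)) x := by
  let inc : primitives k (HopfDual k A) →ₗ[k] Module.Dual k A :=
    (equivDual k A).toLinearMap ∘ₗ (primitives k (HopfDual k A)).toSubmodule.subtype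
  have hinc : Function.Injective inc := (equivDual k A).injective.comp Subtype.val_injective
  have h (j : ι) : ∃ a : A, ∀ f : primitives k (HopfDual k A),
      (f : HopfDual k A) a = b.coord j f := by
    obtain ⟨ξ, hξ⟩ := LinearMap.dualMap_surjective_of_injective hinc (b.coord j)
    refine ⟨(Module.evalEquiv k A).symm ξ, fun f ↦ ?_⟩
    rw [← hξ]
    exact Module.apply_evalEquiv_symm_apply (R := k) (M := A) (inc f) ξ
  choose x hx using h
  refine ⟨fun j ↦ x j - algebraMap k A (counit (x j)), fun i ↦ (b i).2,
    fun i ↦ by simp [RingHom.mem_ker], fun i j ↦ ?_⟩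
  rw [map_sub, hx, Algebra.algebraMap_eq_smul_one, map_smul,
    apply_one_of_mem_primitives (b i).2, smul_zero, sub_zero, b.coord_apply, b.repr_self,
    Finsupp.single_apply]

/-- The primitive elements of the dual are the linear forms that vanish on `1` and on the square of
the augmentation ideal. -/
theorem mem_sq_of_forall_primitives {a : A} (ha : a ∈ RingHom.ker (Bialgebra.counitAlgHom k A))
    (h : ∀ f ∈ primitives k (HopfDual k A), f a = 0) :
    a ∈ RingHom.ker (Bialgebra.counitAlgHom k A) ^ 2 := by
  by_contra hne
  obtain ⟨φ, hφa, hφ⟩ := Submodule.exists_le_ker_of_notMem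
    (p := (RingHom.ker (Bialgebra.counitAlgHom k A) ^ 2).restrictScalars k) hne
  have hI (a : A) : a - algebraMap k A (counit a) ∈ RingHom.ker (Bialgebra.counitAlgHom k A) := by
    simp [RingHom.mem_ker]
  let f : HopfDual k A :=
    (equivDual k A).symm (φ ∘ₗ (LinearMap.id - Algebra.linearMap k A ∘ₗ counit))
  have hf (a : A) : f a = φ (a - algebraMap k A (counit a)) := rfl
  refine hφa ?_
  have h1 := h f (mem_primitives_iff.mpr fun a b ↦ ?_)
  · have h2 : counit (R := k) a = 0 := ha
    rwa [hf, h2, map_zero, sub_zero] at h1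
  · have h2 : φ ((a - algebraMap k A (counit a)) * (b - algebraMap k A (counit b))) = 0 := by
      refine hφ ?_
      rw [sq]
      exact Ideal.mul_mem_mul (hI a) (hI b)
    have h3 : a * b - algebraMap k A (counit (a * b)) =
        (a - algebraMap k A (counit a)) * (b - algebraMap k A (counit b)) +
          counit (R := k) b • (a - algebraMap k A (counit a)) +
          counit (R := k) a • (b - algebraMap k A (counit b)) := by
      simp only [Bialgebra.counit_mul, map_mul, Algebra.smul_def]
      ring
    rw [hf, h3, map_add, map_add, h2, map_smul, map_smul, zero_add, hf, hf, smul_eq_mul,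
      smul_eq_mul, mul_comm (φ _)]

variable {ι : Type*} [Fintype ι] [DecidableEq ι]

/-- If the augmentation ideal is nilpotent, then `A` is generated by a family of elements of the
ideal that is dual to a basis of the primitive elements. -/
theorem adjoin_range_eq_top (hI : IsNilpotent (RingHom.ker (Bialgebra.counitAlgHom k A)))
    {b : Module.Basis ι k (primitives k (HopfDual k A))} {x : ι → A}
    (hx : IsDualSystem (fun i ↦ (b i : HopfDual k A)) x) :
    Algebra.adjoin k (Set.range x) = ⊤ := by
  set I := RingHom.ker (Bialgebra.counitAlgHom k A) with hIdef
  set C := Algebra.adjoin k (Set.range x)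
  -- the generators span the augmentation ideal modulo its square
  have hone (a : A) (ha : a ∈ I) : ∃ c ∈ C, a - c ∈ I ^ 2 := by
    have hc : ∑ i, (b i : HopfDual k A) a • x i ∈ I :=
      sum_mem fun i _ ↦ Submodule.smul_of_tower_mem I _ (hx.mem_ker_counit i)
    refine ⟨∑ i, (b i : HopfDual k A) a • x i,
      sum_mem fun i _ ↦ C.smul_mem (Algebra.subset_adjoin ⟨i, rfl⟩) _,
      mem_sq_of_forall_primitives (sub_mem ha hc) fun f hf ↦ ?_⟩
    let ev : primitives k (HopfDual k A) →ₗ[k] k :=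
      (equivDual k A).toLinearMap.flip (a - ∑ i, (b i : HopfDual k A) a • x i) ∘ₗ
        (primitives k (HopfDual k A)).toSubmodule.subtype
    have hev : ev = 0 := b.ext fun i ↦ by
      change (b i : HopfDual k A) (a - ∑ j, (b j : HopfDual k A) a • x j) = 0
      rw [map_sub, map_sum]
      simp [hx.apply_eq]
    exact congr($hev ⟨f, hf⟩)
  have hstep (m : ℕ) (a : A) (ha : a ∈ I ^ m) : ∃ c ∈ C, a - c ∈ I ^ (m + 1) := by
    induction m generalizing a with
    | zero =>
      refine ⟨algebraMap k A (counit a), C.algebraMap_mem _, ?_⟩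
      rw [zero_add, pow_one]
      simp [hIdef, RingHom.mem_ker]
    | succ m ih =>
      rw [pow_succ] at ha
      induction ha using Submodule.mul_induction_on' with
      | mem_mul_mem a ha b hb =>
        obtain ⟨c, hc, hac⟩ := ih a ha
        obtain ⟨d, hd, hbd⟩ := hone b hb
        refine ⟨c * d, mul_mem hc hd, ?_⟩
        have hcm : c ∈ I ^ m := by
          rw [← sub_sub_cancel a c]
          exact sub_mem ha (Ideal.pow_le_pow_right m.le_succ hac)
        rw [show a * b - c * d = (a - c) * b + c * (b - d) by ring]
        refine add_mem ?_ ?_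
        · rw [pow_succ]
          exact Ideal.mul_mem_mul hac hb
        · rw [show m + 1 + 1 = m + 2 from rfl, pow_add]
          exact Ideal.mul_mem_mul hcm hbd
      | add a _ b _ ha hb =>
        obtain ⟨c, hc, hac⟩ := ha
        obtain ⟨d, hd, hbd⟩ := hb
        refine ⟨c + d, add_mem hc hd, ?_⟩
        rw [add_sub_add_comm]
        exact add_mem hac hbd
  have happrox (m : ℕ) (a : A) : ∃ c ∈ C, a - c ∈ I ^ m := by
    induction m with
    | zero => exact ⟨0, zero_mem C, by simp⟩
    | succ m ih =>
      obtain ⟨c, hc, hac⟩ := ih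
      obtain ⟨d, hd, hcd⟩ := hstep m _ hac
      exact ⟨c + d, add_mem hc hd, by rwa [← sub_sub]⟩
  obtain ⟨n, hn⟩ := hI
  rw [eq_top_iff]
  intro a _
  obtain ⟨c, hc, hac⟩ := happrox n a
  rw [hn, Ideal.zero_eq_bot, Ideal.mem_bot, sub_eq_zero] at hac
  rwa [hac]

variable {p : ℕ}

theorem isNilpotent_ker_counit
    (hpow : ∀ a ∈ RingHom.ker (Bialgebra.counitAlgHom k A), a ^ p = 0) :
    IsNilpotent (RingHom.ker (Bialgebra.counitAlgHom k A)) := by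
  have : IsNoetherianRing A := IsNoetherianRing.of_finite k A
  obtain ⟨n, hn⟩ := IsNoetherianRing.isNilpotent_nilradical A
  refine ⟨n, ?_⟩
  rw [Ideal.zero_eq_bot, eq_bot_iff] at hn ⊢
  refine (Ideal.pow_right_mono (fun a ha ↦ ?_) n).trans hn
  exact mem_nilradical.mpr ⟨p, hpow a ha⟩

theorem finrank_le_pow_finrank_primitives [Fact p.Prime]
    (hpow : ∀ a ∈ RingHom.ker (Bialgebra.counitAlgHom k A), a ^ p = 0) :
    Module.finrank k A ≤ p ^ Module.finrank k (primitives k (HopfDual k A)) := by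
  have hp : p.Prime := Fact.out
  let b := Module.finBasis k (primitives k (HopfDual k A))
  obtain ⟨x, hx⟩ := exists_isDualSystem b
  let W := Submodule.span k (Set.range x)
  have hWI : W ≤ (RingHom.ker (Bialgebra.counitAlgHom k A)).restrictScalars k := by
    rw [Submodule.span_le]
    rintro _ ⟨i, rfl⟩
    exact hx.mem_ker_counit i
  have := FiniteDimensional.span_of_finite k (Set.finite_range x)
  have h := Submodule.finrank_adjoin_le (W := W) hp.two_le
    (fun a _ b _ ↦ by rw [mul_comm, sub_self]; exact zero_mem W)
    (fun a ha ↦ by rw [hpow a (hWI ha)]; exact zero_mem W)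
  rw [Algebra.adjoin_span, adjoin_range_eq_top (isNilpotent_ker_counit hpow) hx,
    subalgebra_top_finrank_eq_submodule_top_finrank, finrank_top] at h
  refine h.trans (Nat.pow_le_pow_right hp.pos ?_)
  exact (finrank_range_le_card x).trans (by simp)

theorem pow_finrank_primitives_le [CharP k p] (B : Subalgebra k (HopfDual k A))
    (hB : ∀ f ∈ primitives k (HopfDual k A), f ∈ B) :
    p ^ Module.finrank k (primitives k (HopfDual k A)) ≤ Module.finrank k B := by
  let b := Module.finBasis k (primitives k (HopfDual k A))
  obtain ⟨x, hx⟩ := exists_isDualSystem b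
  have hli := hx.linearIndependent (p := p)
  have h := finrank_span_eq_card hli
  rw [Fintype.card_fun, Fintype.card_fin, Fintype.card_fin] at h
  rw [← h]
  refine Submodule.finrank_mono (t := Subalgebra.toSubmodule B) (Submodule.span_le.mpr ?_)
  rintro _ ⟨β, rfl⟩
  refine Subalgebra.list_prod_mem B fun f hf ↦ ?_
  obtain ⟨i, -, rfl⟩ := List.mem_map.mp hf
  exact hB _ (b i).2

theorem adjoin_primitives_eq_top [Fact p.Prime] [CharP k p]
    (hpow : ∀ a ∈ RingHom.ker (Bialgebra.counitAlgHom k A), a ^ p = 0) :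
    Algebra.adjoin k (primitives k (HopfDual k A) : Set (HopfDual k A)) = ⊤ := by
  refine Subalgebra.toSubmodule_injective (Submodule.eq_top_of_finrank_eq
    (le_antisymm (Submodule.finrank_le _) ?_))
  rw [finrank_eq]
  exact (finrank_le_pow_finrank_primitives hpow).trans
    (pow_finrank_primitives_le _ fun f hf ↦ Algebra.subset_adjoin hf)

end HopfDual

end HeightOne

section Envelope

open Coalgebra HopfAlgebra

attribute [local instance 100] LieRing.ofAssociativeRing

variable {k A : Type u} [Field k] [CommRing A] [HopfAlgebra k A] [Module.Finite k A]
  {p : ℕ} [Fact p.Prime] [CharP k p]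

instance primitives.instRestrictedLieAlgebra {k H : Type*} [Field k] [CharP k p] [Ring H]
    [Bialgebra k H] : RestrictedLieAlgebra p k (primitives k H) :=
  (primitives k H).restrictedLieAlgebra fun _ ↦ pow_char_mem_primitives p

theorem primitives.coe_lie {k H : Type*} [Field k] [Ring H] [Bialgebra k H]
    (f g : primitives k H) : ((⁅f, g⁆ : primitives k H) : H) = f * g - g * f := rfl

theorem primitives.coe_pMap {k H : Type*} [Field k] [CharP k p] [Ring H] [Bialgebra k H]
    (f : primitives k H) :
    ((RestrictedLieAlgebra.pMap p k f : primitives k H) : H) = (f : H) ^ p := rfl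

namespace RestrictedEnvelopingAlgebra

/-- The dimension is in fact equal to `p ^ finrank k L`, but only this bound is needed. -/
theorem finrank_le (p : ℕ) [Fact p.Prime] (k L : Type*) [Field k] [LieRing L] [LieAlgebra k L]
    [RestrictedLieAlgebra p k L] [Module.Finite k L] :
    Module.finrank k (RestrictedEnvelopingAlgebra p k L) ≤ p ^ Module.finrank k L := by
  have hp : p.Prime := Fact.out
  have h := Submodule.finrank_adjoin_le (W := LinearMap.range (ι (L := L) p k)) hp.two_le
    (by
      rintro _ ⟨x, rfl⟩ _ ⟨y, rfl⟩
      exact ⟨⁅x, y⁆, ι_lie p k x y⟩)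
    (by
      rintro _ ⟨x, rfl⟩
      exact ⟨_, (ι_pow p k x).symm⟩)
  have htop : Algebra.adjoin k
      (LinearMap.range (ι (L := L) p k) : Set (RestrictedEnvelopingAlgebra p k L)) = ⊤ :=
    eq_top_iff.mpr fun y _ ↦
      mem_of_ι_mem _ (fun x ↦ Algebra.subset_adjoin (LinearMap.mem_range_self _ x)) y
  rw [htop, subalgebra_top_finrank_eq_submodule_top_finrank, finrank_top] at h
  exact h.trans (Nat.pow_le_pow_right hp.pos (LinearMap.finrank_range_le _))

variable (p k A)

/-- The algebra homomorphism from the restricted enveloping algebra of the primitive elements of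
the dual that extends the inclusion. -/
def liftPrimitives :
    RestrictedEnvelopingAlgebra p k (primitives k (HopfDual k A)) →ₐ[k] HopfDual k A :=
  lift (primitives k (HopfDual k A)).toSubmodule.subtype (primitives.coe_lie (k := k))
    fun f ↦ (primitives.coe_pMap (p := p) f).symm

theorem liftPrimitives_ι (f : primitives k (HopfDual k A)) :
    liftPrimitives k A p (ι p k f) = f :=
  lift_ι _ _ _ _

/-- The homomorphism `liftPrimitives` as a bialgebra homomorphism. -/
def liftPrimitivesBialgHom :
    RestrictedEnvelopingAlgebra p k (primitives k (HopfDual k A)) →ₐc[k] HopfDual k A :=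
  .ofAlgHom (liftPrimitives k A p)
    (hom_ext fun x ↦ by
      rw [AlgHom.comp_apply, liftPrimitives_ι]
      exact (HopfDual.apply_one_of_mem_primitives x.2).trans (counit_ι p k x).symm)
    (hom_ext fun x ↦ by
      rw [AlgHom.comp_apply, AlgHom.comp_apply, liftPrimitives_ι, Bialgebra.comulAlgHom_apply,
        Bialgebra.comulAlgHom_apply, comul_ι, map_add, Algebra.TensorProduct.map_tmul,
        Algebra.TensorProduct.map_tmul, liftPrimitives_ι, map_one]
      exact (mem_primitives.mp x.2).symm)

variable {A}

/-- Surjectivity holds because the primitive elements generate the dual, and injectivity follows by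
comparing dimensions. -/
theorem bijective_liftPrimitives
    (hpow : ∀ a ∈ RingHom.ker (Bialgebra.counitAlgHom k A), a ^ p = 0) :
    Function.Bijective (liftPrimitives k A p) := by
  have hsurj : Function.Surjective (liftPrimitives k A p) := by
    rw [← AlgHom.range_eq_top, eq_top_iff, ← HopfDual.adjoin_primitives_eq_top hpow]
    exact Algebra.adjoin_le fun f hf ↦ ⟨ι p k ⟨f, hf⟩, liftPrimitives_ι k A p ⟨f, hf⟩⟩
  refine ⟨(LinearMap.injective_iff_surjective_of_finrank_eq_finrank
    (f := (liftPrimitives k A p).toLinearMap) (le_antisymm ?_ ?_)).mpr hsurj, hsurj⟩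
  · refine (finrank_le p k _).trans ((HopfDual.pow_finrank_primitives_le ⊤
      fun _ _ ↦ Algebra.mem_top).trans ?_)
    exact Submodule.finrank_le (Subalgebra.toSubmodule ⊤)
  · exact LinearMap.finrank_le_finrank_of_surjective
      (f := (liftPrimitives k A p).toLinearMap) hsurj

end RestrictedEnvelopingAlgebra

/-- A restricted ideal `J` generates a subalgebra of the dual of dimension at most `p ^ dim J`, so
it is everything only if `J` has the dimension of the Lie algebra of primitive elements. -/
theorem IsSimpleHopf.isSimpleRestricted_primitives (hA : IsSimpleHopf k A)
    (hpow : ∀ a ∈ RingHom.ker (Bialgebra.counitAlgHom k A), a ^ p = 0) :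
    IsSimpleRestricted p k (primitives k (HopfDual k A)) where
  nontrivial := by
    by_contra h
    rw [not_nontrivial_iff_subsingleton] at h
    refine hA.not_top_le_bot ?_
    rw [← HopfDual.adjoin_primitives_eq_top hpow]
    refine Algebra.adjoin_le fun f hf ↦ ?_
    have h0 : f = 0 :=
      congrArg Subtype.val (Subsingleton.elim (⟨f, hf⟩ : primitives k (HopfDual k A)) 0)
    rw [h0]
    exact zero_mem (⊥ : Subalgebra k (HopfDual k A))
  eq_bot_or_eq_top J hJ := by
    have hp : p.Prime := Fact.out
    let S : Submodule k (HopfDual k A) :=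
      J.toSubmodule.map (primitives k (HopfDual k A)).toSubmodule.subtype
    have hmem {f : primitives k (HopfDual k A)} (hf : f ∈ J) :
        (f : HopfDual k A) ∈ Algebra.adjoin k (S : Set (HopfDual k A)) :=
      Algebra.subset_adjoin ⟨f, hf, rfl⟩
    have hfin : Module.finrank k S = Module.finrank k J :=
      (LinearEquiv.finrank_eq (Submodule.equivMapOfInjective _ Subtype.val_injective _)).symm
    refine (hA.adjoin_eq_bot_or_eq_top (S := S) ?_ ?_
      (HopfDual.adjoin_primitives_eq_top hpow) ?_).imp (fun h ↦ ?_) fun h ↦ ?_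
    · rintro _ ⟨f, hf, rfl⟩
      refine ⟨⟨f, hmem hf⟩ ⊗ₜ 1 + 1 ⊗ₜ ⟨f, hmem hf⟩, ?_⟩
      rw [map_add]
      exact (mem_primitives.mp f.2).symm
    · rintro _ ⟨f, hf, rfl⟩
      rw [Submodule.subtype_apply, HopfDual.antipode_of_mem_primitives f.2]
      exact neg_mem (hmem hf)
    · intro t ht b hb
      have hadj (b : HopfDual k A) : HopfDual.adj t b = t * b - b * t := by
        rw [HopfDual.adj, mem_primitives.mp ht, map_add, HopfDual.sandwich_tmul,
          HopfDual.sandwich_tmul, antipode_one, HopfDual.antipode_of_mem_primitives ht]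
        noncomm_ring
      rw [hadj]
      induction hb using Algebra.adjoin_induction with
      | mem x hx =>
        obtain ⟨f, hf, rfl⟩ := hx
        exact hmem (LieSubmodule.lie_mem J (x := (⟨t, ht⟩ : primitives k (HopfDual k A))) hf)
      | algebraMap c =>
        rw [Algebra.commutes, sub_self]
        exact zero_mem _
      | add x y _ _ hx hy =>
        rw [mul_add, add_mul, add_sub_add_comm]
        exact add_mem hx hy
      | mul x y hx' hy' hx hy =>
        rw [show t * (x * y) - x * y * t =
          (t * x - x * t) * y + x * (t * y - y * t) by noncomm_ring]
        exact add_mem (mul_mem hx hy') (mul_mem hx' hy)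
    · rw [eq_bot_iff]
      intro f hf
      obtain ⟨c, hc⟩ := h ▸ hmem hf
      have h1 := HopfDual.apply_one_of_mem_primitives f.2
      rw [← hc] at h1
      have h2 : c = 0 := by simpa using h1
      refine Subtype.ext ?_
      rw [← hc, h2]
      exact map_zero _
    · have h1 := HopfDual.pow_finrank_primitives_le (p := p)
        (Algebra.adjoin k (S : Set (HopfDual k A)))
        fun f _ ↦ h ▸ Algebra.mem_top
      have h2 := h1.trans (Submodule.finrank_adjoin_le (W := S) hp.two_le ?_ ?_)
      · rw [Nat.pow_le_pow_iff_right hp.one_lt, hfin] at h2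
        rw [← LieSubmodule.toSubmodule_eq_top]
        exact Submodule.eq_top_of_finrank_eq (le_antisymm (Submodule.finrank_le _) h2)
      · rintro _ ⟨f, hf, rfl⟩ _ ⟨g, hg, rfl⟩
        exact ⟨_, LieSubmodule.lie_mem J (x := (f : primitives k (HopfDual k A))) hg, rfl⟩
      · rintro _ ⟨f, hf, rfl⟩
        exact ⟨_, hJ f hf, rfl⟩

end Envelope

/-! ### Classification of the simple finite group schemes -/

theorem isIdempotentElem_ker_counit_of_eq_frobeniusIdeal {k A : Type u} [Field k] [CommRing A]
    [HopfAlgebra k A] {p : ℕ} (hp : 2 ≤ p)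
    (h : frobeniusIdeal k A p = RingHom.ker (Bialgebra.counitAlgHom k A)) :
    IsIdempotentElem (RingHom.ker (Bialgebra.counitAlgHom k A)) := by
  refine le_antisymm Ideal.mul_le_left ?_
  rw [← pow_two]
  conv_lhs => rw [← h]
  refine Ideal.span_le.mpr ?_
  rintro _ ⟨a, ha, rfl⟩
  exact Ideal.pow_le_pow_right hp (Ideal.pow_mem_pow ha p)

theorem mainTheorem7 {k : Type u} [Field k] [IsAlgClosed k] (p : ℕ) [Fact p.Prime] [CharP k p]
    (G : Grp (Over (Spec (.of k)))) [IsFinite G.X.hom] (hG : IsSimpleGroupScheme G) :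
    (∃ (Γ : Type u) (_ : Group Γ) (_ : Finite Γ),
      IsSimpleGroup Γ ∧ Nonempty (G ≅ constantGroupScheme k Γ)) ∨
    (∃ (L : Type u) (_ : LieRing L) (_ : LieAlgebra k L) (_ : Module.Finite k L)
      (_ : RestrictedLieAlgebra p k L),
      IsSimpleRestricted p k L ∧ Nonempty (G ≅ heightOneGroupScheme p k L)) := by
  have hp : p.Prime := Fact.out
  obtain ⟨A, _, _, _, ⟨e⟩⟩ := exists_iso_hopfSpec_of_isFinite G
  have hA : IsSimpleHopf k A := isSimpleHopf_of_isSimpleGroupScheme (hG.of_iso e.symm)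
  -- the kernel of the Frobenius morphism is all of `G` or trivial
  rcases hA.eq_bot_or_eq_ker (frobeniusIdeal k A p) (frobeniusIdeal_normal p) with h | h
  · have hpow (a : A) (ha : a ∈ RingHom.ker (Bialgebra.counitAlgHom k A)) : a ^ p = 0 := by
      have := pow_mem_frobeniusIdeal (k := k) p ha
      rwa [h] at this
    let := LieRing.ofAssociativeRing (A := HopfDual k A)
    obtain ⟨e'⟩ := nonempty_iso_of_bijective
      (Ψ := RestrictedEnvelopingAlgebra.liftPrimitivesBialgHom k A p)
      (RestrictedEnvelopingAlgebra.bijective_liftPrimitives k p hpow)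
    exact .inr ⟨primitives k (HopfDual k A), inferInstance, inferInstance, inferInstance,
      inferInstance, hA.isSimpleRestricted_primitives hpow, ⟨e.symm ≪≫ e'⟩⟩
  · have hbij := bijective_liftGroupLikeBialgHom fun _ ↦
      eq_zero_of_forall_point (isIdempotentElem_ker_counit_of_eq_frobeniusIdeal hp.two_le h)
    have := finite_groupLike (k := k) (A := A)
    obtain ⟨e'⟩ : Nonempty ((hopfSpec (.of k)).obj (op (.of k A)) ≅
        constantGroupScheme k (GroupLike k (HopfDual k A))) := nonempty_iso_of_bijective hbij
    exact .inl ⟨GroupLike k (HopfDual k A), inferInstance, inferInstance,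
      hA.isSimpleGroup_groupLike hbij.2, ⟨e.symm ≪≫ e'⟩⟩

end
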